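/- **Setting.** Let $E$ be a complex Banach space with dual $E'$, and let $\mathcal P(^jE)$ be the space of continuous $j$-homogeneous polynomials $E\to\mathbb C$. Let $\mathcal P_f(^jE)$ be the linear span of $\{\phi^j:\phi\in E'\}$. For an entire function $f$ let $\hat d^jf(a)$ be its $j$-th derivative at $a$, so that $f(x)=\sum_j\frac1{j!}\hat d^jf(a)(x-a)$ near $a$. A *holomorphy type* $\Theta$ from $E$ to $\mathbb C$ is a sequence of Banach spaces $(\mathcal P_\Theta(^jE),\|\cdot\|_\Theta)_{j\ge0}$ with the following properties. Each $\mathcal P_\Theta(^jE)$ is a vector subspace of $\mathcal P(^jE)$; $\mathcal P_\Theta(^0E)=\mathbb C$ as a normed space; and there is $\sigma\ge1$ such that for all $k\le j$, $a\in E$ and $P\in\mathcal P_\Theta(^jE)$ one has $\hat d^kP(a)\in\mathcal P_\Theta(^kE)$ and $\|\frac1{k!}\hat d^kP(a)\|_\Theta\le\sigma^j\|P\|_\Theta\|a\|^{j-k}$. For $k\in(1,\infty]$ put $w_k(j)=(j/(ke))^{j/k}$, with $w_\infty(j)=1$ and $w_k(0)=1$. Let $Exp^k_{\Theta,0}(E)$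 be the space of entire $f$ with $\hat d^jf(0)\in\mathcal P_\Theta(^jE)$ for all $j$ and $$\|f\|_{\Theta,k,\rho}=\sum_j\rho^{-j}w_k(j)\Big\|\tfrac1{j!}\hat d^jf(0)\Big\|_\Theta<\infty\quad\text{for all }\rho>0,$$ with the locally convex topology generated by the norms $\|\cdot\|_{\Theta,k,\rho}$, $\rho>0$. * $\Theta$ is a *$\pi_1$-holomorphy type* if $\mathcal P_f(^jE)$ is contained and dense in $\mathcal P_\Theta(^jE)$ for every $j$, and there is $K>0$ with $\|\phi^j\cdot b\|_\Theta\le K^j\|\phi\|^j|b|$ for all $\phi\in E'$, $b\in\mathbb C$ and $j\ge 0$. * $\Theta$ is a *$\pi_{2,k}$-holomorphy type* if the following holds for every $T\in[Exp^k_{\Theta,0}(E)]'$. First, for all $m\le j$ and $P\in\mathcal P_\Theta(^jE)$ with symmetric $j$-linear map $\check P$, the function $T_{P,m}(y)=T\big(x\mapsto\check P(x^m,y^{j-m})\big)$ belongs to $\mathcal P_\Theta(^{j-m}E)$. Second, whenever $C,\rho>0$ satisfy $|T(f)|\le C\|f\|_{\Theta,k,\rho}$ for all $f$, there is $M>0$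 such that $\|T_{P,m}\|_\Theta\le CM^j\rho^{-m}w_k(m)\|P\|_\Theta$ for all such $j,m,P$. Let $\Theta$ be a $\pi_1$-holomorphy type. Let $\mathcal P_{\Theta'}(^jE')$ be the range of the (injective) Borel transform $T\in[\mathcal P_\Theta(^jE)]'\mapsto(\phi\mapsto T(\phi^j))$, normed by letting the norm of the image of $T$ be $\|T\|$. Let $k'$ be the conjugate exponent of $k$ ($k'=1$ if $k=\infty$). Then $Exp^{k'}_{\Theta'}(E')$ is the space of entire $f:E'\to\mathbb C$ with $\hat d^jf(0)\in\mathcal P_{\Theta'}(^jE')$ for all $j$ and $\sum_j\rho^{-j}w_{k'}(j)\|\frac1{j!}\hat d^jf(0)\|_{\Theta'}<\infty$ for some $\rho>0$. It is *closed under division* if, whenever $f,g$ belong to it, $g\ne0$, and $h$ is entire on $E'$ with $f=hg$, then $h$ belongs to it. For $T\in[Exp^k_{\Theta,0}(E)]'$ and $f\in Exp^k_{\Theta,0}(E)$ let $(T*f)(x)=T(f(\cdot+x))$ for $x\in E$, and let $\mathcal FT(\phi)=T(e^\phi)$ for $\phi\in E'$. **Theorem 5.3.** Let $k\in(1,\infty]$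 and let $\Theta$ be a holomorphy type from $E$ to $\mathbb C$ that is both a $\pi_1$- and a $\pi_{2,k}$-holomorphy type. Suppose that $Exp^{k'}_{\Theta'}(E')$ is closed under division. Let $T_1,T_2\in[Exp^k_{\Theta,0}(E)]'$ with $T_2\ne0$ be such that $T_1(P\,e^\phi)=0$ whenever $\phi\in E'$, $m\ge0$ and $P\in\mathcal P_\Theta(^mE)$ satisfy $P\,e^\phi\in Exp^k_{\Theta,0}(E)$ and $T_2*(P\,e^\phi)=0$. Then $\mathcal FT_1$ is divisible by $\mathcal FT_2$ with quotient in $Exp^{k'}_{\Theta'}(E')$: there is $h\in Exp^{k'}_{\Theta'}(E')$ such that $\mathcal FT_1(\phi)=h(\phi)\,\mathcal FT_2(\phi)$ for all $\phi\in E'$. -/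

import Mathlib

open scoped ENNReal Topology

namespace HoloType

section Basics

variable {E : Type*} [NormedAddCommGroup E] [NormedSpace ℂ E]

/-- `f : E → ℂ` is an entire (holomorphic on all of `E`) function. -/
def Entire (f : E → ℂ) : Prop := AnalyticOnNhd ℂ f Set.univ

/-- The `m`-th derivative `d̂ᵐ f(a)`, the `m`-homogeneous polynomial `x ↦ dᵐf(a)(x, …, x)`. -/
noncomputable def dhat (m : ℕ) (f : E → ℂ) (a : E) : E → ℂ :=
  fun x => iteratedFDeriv ℂ m f a (fun _ => x)

/-- The `m`-th Taylor polynomial `(1 / m!) d̂ᵐ f(a)`. -/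
noncomputable def taylorPoly (m : ℕ) (f : E → ℂ) (a : E) : E → ℂ :=
  (m.factorial : ℂ)⁻¹ • dhat m f a

variable (E) in
/-- The space `𝒫(ᵐE)` of continuous `m`-homogeneous polynomials `E → ℂ`, as functions. -/
def homPoly (m : ℕ) : Submodule ℂ (E → ℂ) where
  carrier := {P | ∃ B : ContinuousMultilinearMap ℂ (fun _ : Fin m => E) ℂ,
    ∀ x, P x = B (fun _ => x)}
  zero_mem' := ⟨0, fun _ => by simp⟩
  add_mem' := by
    rintro P Q ⟨B, hB⟩ ⟨C, hC⟩
    exact ⟨B + C, fun x => by simp [hB, hC]⟩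
  smul_mem' := by
    rintro c P ⟨B, hB⟩
    exact ⟨c • B, fun x => by simp [hB]⟩

variable (E) in
/-- The space `𝒫_f(ᵐE)` of `m`-homogeneous polynomials of finite type: the linear span of the
powers `φᵐ` of continuous linear functionals. -/
def finitePoly (m : ℕ) : Submodule ℂ (E → ℂ) :=
  Submodule.span ℂ (Set.range fun φ : E →L[ℂ] ℂ => fun x : E => φ x ^ m)

theorem Entire.contDiff {f : E → ℂ} (hf : Entire f) : ContDiff ℂ ⊤ f :=
  AnalyticOnNhd.contDiff hf

theorem Entire.add {f g : E → ℂ} (hf : Entire f) (hg : Entire g) : Entire (f + g) :=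
  AnalyticOnNhd.add hf hg

theorem Entire.smul {f : E → ℂ} (c : ℂ) (hf : Entire f) : Entire (c • f) :=
  AnalyticOnNhd.const_smul hf

theorem Entire.translate {f : E → ℂ} (hf : Entire f) (a : E) : Entire (fun y => f (y + a)) := by
  intro y _
  have h : AnalyticAt ℂ (fun y : E => y + a) y := analyticAt_id.add analyticAt_const
  exact AnalyticAt.comp (g := f) (f := fun y : E => y + a) (hf (y + a) trivial) h

theorem Entire.differentiable_line {f : E → ℂ} (hf : Entire f) (a x : E) :
    Differentiable ℂ (fun t : ℂ => f (a + t • x)) := by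
  have h1 : Differentiable ℂ f := hf.contDiff.differentiable (by simp)
  exact h1.comp (by fun_prop)

theorem entire_of_homPoly {m : ℕ} {P : E → ℂ} (hP : P ∈ homPoly E m) : Entire P := by
  obtain ⟨B, hB⟩ := hP
  have : P = fun x => B (fun _ => x) := funext hB
  rw [this]
  intro x _
  have h1 : AnalyticAt ℂ B (fun _ => x) := B.analyticAt
  have h2 : AnalyticAt ℂ (fun x : E => (fun _ : Fin m => x)) x := by
    have := (ContinuousLinearMap.pi (R := ℂ) (fun _ : Fin m => ContinuousLinearMap.id ℂ E)).analyticAt x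
    exact this
  exact h1.comp h2

theorem dhat_add {f g : E → ℂ} (hf : Entire f) (hg : Entire g) (m : ℕ) (a : E) :
    dhat m (f + g) a = dhat m f a + dhat m g a := by
  funext x
  have h1 := (hf.contDiff.contDiffAt (x := a)).of_le (m := (m : ℕ∞)) le_top
  have h2 := (hg.contDiff.contDiffAt (x := a)).of_le (m := (m : ℕ∞)) le_top
  simp only [dhat, Pi.add_apply]
  rw [iteratedFDeriv_add_apply h1 h2]
  simp

theorem dhat_smul {f : E → ℂ} (hf : Entire f) (c : ℂ) (m : ℕ) (a : E) :
    dhat m (c • f) a = c • dhat m f a := by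
  funext x
  have h1 := (hf.contDiff.contDiffAt (x := a)).of_le (m := (m : ℕ∞)) le_top
  simp only [dhat, Pi.smul_apply]
  rw [iteratedFDeriv_const_smul_apply h1]
  simp

theorem dhat_eq_line {f : E → ℂ} (hf : Entire f) (m : ℕ) (a x : E) :
    dhat m f a x = iteratedDeriv m (fun t : ℂ => f (a + t • x)) 0 := by
  have hc : ContDiff ℂ ⊤ (fun y => f (a + y)) := hf.contDiff.comp (by fun_prop)
  have h1 : (fun t : ℂ => f (a + t • x)) =
      (fun y => f (a + y)) ∘ (ContinuousLinearMap.toSpanSingleton ℂ x) := by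
    funext t; simp
  rw [iteratedDeriv_eq_iteratedFDeriv, h1,
    ContinuousLinearMap.iteratedFDeriv_comp_right _ hc _ le_top]
  simp [dhat, iteratedFDeriv_comp_add_left]

theorem iteratedDeriv_of_hasSum {g : ℂ → ℂ} {c : ℕ → ℂ}
    (h : ∀ t, HasSum (fun n => t ^ n * c n) (g t)) (n : ℕ) :
    iteratedDeriv n g 0 = n.factorial * c n := by
  have h1 : HasFPowerSeriesAt g (FormalMultilinearSeries.ofScalars ℂ c) 0 := by
    rw [hasFPowerSeriesAt_iff]
    refine Filter.Eventually.of_forall fun t => ?_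
    simpa using h t
  have h2 := h1.analyticAt.hasFPowerSeriesAt
  have h3 := h1.eq_formalMultilinearSeries h2
  have h4 := congrArg (fun p => p.coeff n) h3
  simp only [FormalMultilinearSeries.coeff_ofScalars] at h4
  have : (n.factorial : ℂ) ≠ 0 := by exact_mod_cast n.factorial_ne_zero
  rw [h4]
  field_simp

theorem dhat_of_hasSum {f : E → ℂ} (hf : Entire f) {a x : E} {c : ℕ → ℂ}
    (h : ∀ t : ℂ, HasSum (fun n => t ^ n * c n) (f (a + t • x))) (n : ℕ) :
    taylorPoly n f a x = c n := by
  rw [taylorPoly, Pi.smul_apply, dhat_eq_line hf, iteratedDeriv_of_hasSum h]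
  have : (n.factorial : ℂ) ≠ 0 := by exact_mod_cast n.factorial_ne_zero
  simp [this]

theorem Entire.hasSum_line {f : E → ℂ} (hf : Entire f) (a x : E) (t : ℂ) :
    HasSum (fun n => t ^ n * taylorPoly n f a x) (f (a + t • x)) := by
  have h := Complex.hasSum_taylorSeries_of_entire (hf.differentiable_line a x) 0 t
  have e : ∀ n, (n.factorial : ℂ)⁻¹ • (t - 0) ^ n • iteratedDeriv n (fun t : ℂ => f (a + t • x)) 0
      = t ^ n * taylorPoly n f a x := by
    intro n
    rw [taylorPoly, Pi.smul_apply, dhat_eq_line hf]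
    simp only [smul_eq_mul, sub_zero]; ring
  simpa only [e] using h

/-- Polarised binomial expansion. -/
theorem multilinear_line {j : ℕ} (B : ContinuousMultilinearMap ℂ (fun _ : Fin j => E) ℂ)
    (a x : E) (t : ℂ) :
    HasSum (fun n => t ^ n * ∑ s : Finset (Fin j) with s.card = n,
      B (s.piecewise (fun _ => x) (fun _ => a))) (B (fun _ => a + t • x)) := by
  have h0 : B (fun _ => a + t • x) = ∑ s : Finset (Fin j),
      t ^ s.card * B (s.piecewise (fun _ => x) (fun _ => a)) := by
    have h1 : (fun _ : Fin j => a + t • x) = (fun _ => t • x) + (fun _ => a) := by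
      funext i; simp [add_comm]
    rw [h1, ContinuousMultilinearMap.map_add_univ]
    refine Finset.sum_congr rfl fun s _ => ?_
    have h2 := B.toMultilinearMap.map_piecewise_smul (fun _ => t)
      (s.piecewise (fun _ => x) (fun _ => a)) s
    have h3 : s.piecewise (fun i => t • s.piecewise (fun _ => x) (fun _ => a) i)
        (s.piecewise (fun _ => x) (fun _ => a)) = s.piecewise (fun _ => t • x) (fun _ => a) := by
      funext i
      by_cases hi : i ∈ s <;> simp [hi]
    rw [h3] at h2
    simpa using h2
  rw [h0, ← Finset.sum_fiberwise_of_maps_to (g := Finset.card) (t := Finset.range (j + 1))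
    (fun s _ => Finset.mem_range.2 (by
      have := Finset.card_le_univ s
      simp at this; omega))]
  have e : ∀ n, ∑ s : Finset (Fin j) with s.card = n,
      t ^ s.card * B (s.piecewise (fun _ => x) (fun _ => a)) =
      t ^ n * ∑ s : Finset (Fin j) with s.card = n,
        B (s.piecewise (fun _ => x) (fun _ => a)) := by
    intro n
    rw [Finset.mul_sum]
    refine Finset.sum_congr rfl fun s hs => ?_
    rw [(Finset.mem_filter.1 hs).2]
  simp only [e]
  refine hasSum_sum_of_ne_finset_zero fun n hn => ?_
  rw [Finset.sum_eq_zero, mul_zero]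
  intro s hs
  exfalso
  apply hn
  rw [← (Finset.mem_filter.1 hs).2, Finset.mem_range]
  have := Finset.card_le_univ s
  simp at this; omega

theorem taylorPoly_homPoly {j : ℕ} {P : E → ℂ}
    {B : ContinuousMultilinearMap ℂ (fun _ : Fin j => E) ℂ} (hB : ∀ x, P x = B (fun _ => x))
    (n : ℕ) (a x : E) :
    taylorPoly n P a x = ∑ s : Finset (Fin j) with s.card = n,
      B (s.piecewise (fun _ => x) (fun _ => a)) := by
  refine dhat_of_hasSum (entire_of_homPoly ⟨B, hB⟩) (c := fun n =>
    ∑ s : Finset (Fin j) with s.card = n, B (s.piecewise (fun _ => x) (fun _ => a)))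
    (fun t => ?_) n
  rw [hB]
  exact multilinear_line B a x t

theorem taylorPoly_homPoly_of_lt {j n : ℕ} (hn : j < n) {P : E → ℂ} (hP : P ∈ homPoly E j)
    (a : E) : taylorPoly n P a = 0 := by
  obtain ⟨B, hB⟩ := hP
  funext x
  rw [taylorPoly_homPoly hB, Finset.sum_eq_zero, Pi.zero_apply]
  intro s hs
  exfalso
  have := Finset.card_le_univ s
  have h2 := (Finset.mem_filter.1 hs).2
  simp at this; omega

theorem homPoly_smul {j : ℕ} {P : E → ℂ} (hP : P ∈ homPoly E j) (t : ℂ) (x : E) :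
    P (t • x) = t ^ j * P x := by
  obtain ⟨B, hB⟩ := hP
  rw [hB, hB]
  have := B.map_smul_univ (fun _ => t) (fun _ => x)
  simpa using this

theorem taylorPoly_homPoly_zero {j : ℕ} {P : E → ℂ} (hP : P ∈ homPoly E j) (n : ℕ) :
    taylorPoly n P 0 = if n = j then P else 0 := by
  funext x
  have : taylorPoly n P 0 x = if n = j then P x else 0 := by
    refine dhat_of_hasSum (entire_of_homPoly hP) (c := fun n => if n = j then P x else 0)
      (fun t => ?_) n
    rw [zero_add, homPoly_smul hP]
    convert hasSum_ite_eq j (t ^ j * P x) using 2 with n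
    split_ifs with h
    · rw [h]
    · simp
  rw [this]; split_ifs <;> rfl

/-- The argument vector `(x, …, x, y, …, y)` with `m` entries `x` and `j - m` entries `y`. -/
def mixed {j : ℕ} (m : ℕ) (x y : E) : Fin j → E := fun i => if (i : ℕ) < m then x else y

theorem mixed_eq_taylorPoly {j m : ℕ} (hm : m ≤ j) {P : E → ℂ}
    {B : ContinuousMultilinearMap ℂ (fun _ : Fin j => E) ℂ}
    (hsymm : ∀ (τ : Equiv.Perm (Fin j)) (v : Fin j → E), B (fun i => v (τ i)) = B v)
    (hB : ∀ x, P x = B (fun _ => x)) (y : E) :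
    (fun x => B (mixed m x y)) = (j.choose m : ℂ)⁻¹ • taylorPoly m P y := by
  funext x
  rw [Pi.smul_apply, taylorPoly_homPoly hB]
  have key : ∀ s ∈ (Finset.univ : Finset (Finset (Fin j))).filter (fun s => s.card = m),
      B (s.piecewise (fun _ => x) (fun _ => y)) = B (mixed m x y) := by
    intro s hs
    have hs := (Finset.mem_filter.1 hs).2
    let s0 : Finset (Fin j) := Finset.univ.filter (fun i => (i : ℕ) < m)
    have hs0 : s0.card = m := by
      simp only [s0]
      rw [Fin.card_filter_val_lt]; omega
    obtain ⟨τ, hτ⟩ : ∃ τ : Equiv.Perm (Fin j), ∀ i, τ i ∈ s ↔ i ∈ s0 := by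
      let e := Finset.equivOfCardEq (hs0.trans hs.symm)
      refine ⟨e.extendSubtype, fun i => ?_⟩
      constructor
      · intro h
        by_contra hi
        exact e.extendSubtype_not_mem i hi h
      · intro hi
        exact e.extendSubtype_mem i hi
    rw [← hsymm τ]
    congr 1
    funext i
    by_cases hi : i ∈ s0
    · have h2 : (i : ℕ) < m := by simpa [s0] using hi
      simp [mixed, h2, (hτ i).2 hi]
    · have h2 : ¬ (i : ℕ) < m := by simpa [s0] using hi
      have h3 : τ i ∉ s := fun h => hi ((hτ i).1 h)
      simp [mixed, h2, h3]
  rw [Finset.sum_congr rfl key, Finset.sum_const]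
  have hc : ((Finset.univ : Finset (Finset (Fin j))).filter (fun s => s.card = m)).card
      = j.choose m := by
    have := Finset.card_powersetCard m (Finset.univ : Finset (Fin j))
    rw [Finset.card_univ, Fintype.card_fin] at this
    rw [← this]
    congr 1
    ext s; simp
  rw [hc]
  have : (j.choose m : ℂ) ≠ 0 := by exact_mod_cast (Nat.choose_pos hm).ne'
  simp [this]

theorem entire_exp (φ : E →L[ℂ] ℂ) : Entire (fun x => Complex.exp (φ x)) :=
  fun x _ => (φ.analyticAt x).cexp

theorem taylorPoly_exp (φ : E →L[ℂ] ℂ) (n : ℕ) :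
    taylorPoly n (fun x => Complex.exp (φ x)) 0 =
      (n.factorial : ℂ)⁻¹ • fun x => φ x ^ n := by
  funext x
  refine dhat_of_hasSum (entire_exp φ) (c := fun n => (n.factorial : ℂ)⁻¹ * φ x ^ n) (fun t => ?_) n
  have := NormedSpace.expSeries_div_hasSum_exp (𝔸 := ℂ) (φ (t • x))
  rw [← Complex.exp_eq_exp_ℂ] at this
  rw [zero_add]
  have e : ∀ n : ℕ, t ^ n * ((n.factorial : ℂ)⁻¹ * φ x ^ n) = φ (t • x) ^ n / n.factorial := by
    intro n
    simp only [map_smul, smul_eq_mul, mul_pow]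
    ring
  simpa only [e] using this

end Basics
end HoloType
namespace HoloType

section Weights

/-- The weight `(j / (k e)) ^ (j / k)`, read as `1` when `k = ∞` (and as `1` when `j = 0`). -/
noncomputable def orderWeight (k : ℝ≥0∞) (j : ℕ) : ℝ :=
  if k = ⊤ then 1 else ((j : ℝ) / (k.toReal * Real.exp 1)) ^ ((j : ℝ) / k.toReal)

theorem orderWeight_nonneg (k : ℝ≥0∞) (j : ℕ) : 0 ≤ orderWeight k j := by
  unfold orderWeight; split_ifs <;> positivity

theorem orderWeight_zero (k : ℝ≥0∞) : orderWeight k 0 = 1 := by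
  unfold orderWeight; split_ifs <;> simp

theorem orderWeight_eq_exp {k : ℝ≥0∞} (hk : 1 ≤ k) (hk' : k ≠ ⊤) {j : ℕ} (hj : j ≠ 0) :
    orderWeight k j = Real.exp ((j / k.toReal) * (Real.log (j / k.toReal) - 1)) := by
  have h1 : 0 < k.toReal := ENNReal.toReal_pos (by rintro rfl; simp at hk) hk'
  have h2 : (0 : ℝ) < j := by exact_mod_cast Nat.pos_of_ne_zero hj
  rw [orderWeight, if_neg hk', Real.rpow_def_of_pos (by positivity), ← div_div,
    Real.log_div (by positivity) (by positivity), Real.log_exp, mul_comm]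

theorem exp_neg_one_le_orderWeight {k : ℝ≥0∞} (hk : 1 ≤ k) (j : ℕ) :
    Real.exp (-1) ≤ orderWeight k j := by
  have h0 : Real.exp (-1) ≤ 1 := by simp
  by_cases hk' : k = ⊤
  · simp [orderWeight, hk']
  by_cases hj : j = 0
  · subst hj; rwa [orderWeight_zero]
  rw [orderWeight_eq_exp hk hk' hj, Real.exp_le_exp]
  have h1 : 0 < k.toReal := ENNReal.toReal_pos (by rintro rfl; simp at hk) hk'
  have h2 : (0 : ℝ) < j := by exact_mod_cast Nat.pos_of_ne_zero hj
  have hu : 0 < (j : ℝ) / k.toReal := by positivity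
  set u := (j : ℝ) / k.toReal
  have h3 := Real.log_le_sub_one_of_pos (inv_pos.2 hu)
  rw [Real.log_inv] at h3
  have h4 : u * (-Real.log u) ≤ u * (u⁻¹ - 1) := mul_le_mul_of_nonneg_left h3 hu.le
  have h5 : u * u⁻¹ = 1 := mul_inv_cancel₀ hu.ne'
  nlinarith

theorem orderWeight_le {k : ℝ≥0∞} (hk : 1 ≤ k) {n j : ℕ} (hnj : n ≤ j) :
    orderWeight k n ≤ Real.exp 1 * orderWeight k j := by
  have hone : 1 ≤ Real.exp 1 * orderWeight k j := by
    have := mul_le_mul_of_nonneg_left (exp_neg_one_le_orderWeight hk j) (Real.exp_pos 1).le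
    rwa [← Real.exp_add, add_neg_cancel, Real.exp_zero] at this
  by_cases hk' : k = ⊤
  · refine le_trans ?_ hone
    simp [orderWeight, hk']
  by_cases hn : n = 0
  · subst hn; rwa [orderWeight_zero]
  have h1 : 0 < k.toReal := ENNReal.toReal_pos (by rintro rfl; simp at hk) hk'
  have h2 : (0 : ℝ) < n := by exact_mod_cast Nat.pos_of_ne_zero hn
  have hj : j ≠ 0 := by omega
  have huv : (n : ℝ) / k.toReal ≤ j / k.toReal := by gcongr
  have hu : 0 < (n : ℝ) / k.toReal := by positivity
  have e1 := orderWeight_eq_exp hk hk' hn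
  have e2 := orderWeight_eq_exp hk hk' hj
  set u := (n : ℝ) / k.toReal
  set v := (j : ℝ) / k.toReal
  by_cases hlog : Real.log u ≤ 1
  · refine le_trans ?_ hone
    rw [e1, Real.exp_le_one_iff]
    exact mul_nonpos_of_nonneg_of_nonpos hu.le (by linarith)
  · push Not at hlog
    have hlog2 : Real.log u ≤ Real.log v := Real.log_le_log hu huv
    have h6 : orderWeight k n ≤ orderWeight k j := by
      rw [e1, e2, Real.exp_le_exp]
      apply mul_le_mul huv (by linarith) (by linarith) (by linarith)
    refine h6.trans ?_
    have : (1 : ℝ) ≤ Real.exp 1 := by simp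
    nlinarith [orderWeight_nonneg k j]

theorem summable_orderWeight_exp {k : ℝ≥0∞} (hk : 1 < k) {R : ℝ} (hR : 0 ≤ R) :
    Summable fun j : ℕ => R ^ j * orderWeight k j / j.factorial := by
  by_cases hk' : k = ⊤
  · simpa [orderWeight, hk'] using Real.summable_pow_div_factorial R
  set q := k.toReal with hq
  have h1 : 1 < q := by
    rw [hq]; rw [← ENNReal.ofReal_lt_iff_lt_toReal zero_le_one hk']; simpa using hk
  have hw : ∀ j : ℕ, orderWeight k j ≤ (j.factorial : ℝ) ^ q⁻¹ := by
    intro j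
    by_cases hj : j = 0
    · subst hj; simp [orderWeight_zero]
    rw [orderWeight, if_neg hk', ← hq]
    have h2 : (j : ℝ) / (q * Real.exp 1) ≤ j / Real.exp 1 := by
      gcongr
      nlinarith [Real.exp_pos 1]
    calc ((j : ℝ) / (q * Real.exp 1)) ^ ((j : ℝ) / q)
        ≤ ((j : ℝ) / Real.exp 1) ^ ((j : ℝ) / q) := by gcongr
      _ = (((j : ℝ) / Real.exp 1) ^ j) ^ q⁻¹ := by
          rw [div_eq_mul_inv (j : ℝ) q, Real.rpow_mul (by positivity), Real.rpow_natCast]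
      _ ≤ (j.factorial : ℝ) ^ q⁻¹ := by
          gcongr
          have := Real.pow_div_factorial_le_exp (j : ℝ) (by positivity) j
          rw [div_pow, ← Real.exp_nat_mul, mul_one, div_le_iff₀ (Real.exp_pos _)]
          rw [div_le_iff₀ (by positivity)] at this
          linarith
  set s := 1 - q⁻¹ with hs
  have hs0 : 0 < s := by
    rw [hs, sub_pos]; exact inv_lt_one_of_one_lt₀ h1
  set M : ℝ := (2 * R) ^ s⁻¹ with hM
  have hM0 : 0 ≤ M := by positivity
  obtain ⟨C, hC⟩ : ∃ C : ℝ, ∀ j : ℕ, M ^ j / j.factorial ≤ C := by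
    refine ⟨Real.exp M, fun j => Real.pow_div_factorial_le_exp M hM0 j⟩
  have hbound : ∀ j : ℕ, R ^ j * orderWeight k j / j.factorial ≤ C ^ s * (1 / 2) ^ j := by
    intro j
    have hf : (0 : ℝ) < j.factorial := by positivity
    have h3 : (M ^ j / j.factorial) ^ s ≤ C ^ s :=
      Real.rpow_le_rpow (by positivity) (hC j) hs0.le
    have h4 : (M ^ j / j.factorial : ℝ) ^ s = (2 * R) ^ j / (j.factorial : ℝ) ^ s := by
      rw [Real.div_rpow (by positivity) hf.le, hM, ← Real.rpow_natCast, ← Real.rpow_mul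
        (by positivity), ← Real.rpow_mul (by positivity), mul_left_comm, inv_mul_cancel₀ hs0.ne',
        mul_one, Real.rpow_natCast]
    have h5 : (j.factorial : ℝ) ^ q⁻¹ / j.factorial = 1 / (j.factorial : ℝ) ^ s := by
      rw [hs, Real.rpow_sub hf, Real.rpow_one]
      field_simp
    calc R ^ j * orderWeight k j / j.factorial
        ≤ R ^ j * (j.factorial : ℝ) ^ q⁻¹ / j.factorial := by gcongr; exact hw j
      _ = R ^ j * (1 / (j.factorial : ℝ) ^ s) := by rw [← h5]; ring
      _ = ((2 * R) ^ j / (j.factorial : ℝ) ^ s) * (1 / 2) ^ j := by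
          rw [mul_pow, one_div_pow]; field_simp
      _ ≤ C ^ s * (1 / 2) ^ j := by
          rw [← h4]; gcongr
  refine Summable.of_nonneg_of_le (fun j => ?_) hbound
    ((summable_geometric_of_lt_one (by norm_num) (by norm_num)).mul_left _)
  have := orderWeight_nonneg k j
  positivity

end Weights
end HoloType
namespace HoloType

section Types

/-- A sequence `(𝒫_Θ(ʲE))_j` of vector subspaces of the spaces `𝒫(ʲE)` of continuous homogeneous
polynomials, each with a norm of its own. -/
structure PolySeq (E : Type*) [NormedAddCommGroup E] [NormedSpace ℂ E] where
  /-- the space `𝒫_Θ(ʲE)` -/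
  space : ℕ → Submodule ℂ (E → ℂ)
  le_homPoly : ∀ j, space j ≤ homPoly E j
  /-- the norm `‖·‖_Θ` of `𝒫_Θ(ʲE)` -/
  nrm : ∀ j, space j → ℝ
  nrm_nonneg : ∀ j P, 0 ≤ nrm j P
  nrm_smul : ∀ j (c : ℂ) P, nrm j (c • P) = ‖c‖ * nrm j P
  nrm_add_le : ∀ j P Q, nrm j (P + Q) ≤ nrm j P + nrm j Q
  nrm_eq_zero_iff : ∀ j P, nrm j P = 0 ↔ P = 0

variable {E : Type*} [NormedAddCommGroup E] [NormedSpace ℂ E]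

/-- `𝒫_Θ(ʲE)` as a normed space with the norm `‖·‖_Θ`. -/
def PolySeq.Poly (S : PolySeq E) (j : ℕ) : Type _ := S.space j

instance (S : PolySeq E) (j : ℕ) : AddCommGroup (S.Poly j) :=
  inferInstanceAs (AddCommGroup (S.space j))

instance (S : PolySeq E) (j : ℕ) : Module ℂ (S.Poly j) :=
  inferInstanceAs (Module ℂ (S.space j))

instance (S : PolySeq E) (j : ℕ) : Norm (S.Poly j) := ⟨S.nrm j⟩

theorem PolySeq.core (S : PolySeq E) (j : ℕ) : NormedSpace.Core ℂ (S.Poly j) where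
  norm_nonneg := S.nrm_nonneg j
  norm_smul := S.nrm_smul j
  norm_triangle := S.nrm_add_le j
  norm_eq_zero_iff := S.nrm_eq_zero_iff j

noncomputable instance (S : PolySeq E) (j : ℕ) : NormedAddCommGroup (S.Poly j) :=
  NormedAddCommGroup.ofCore (S.core j)

noncomputable instance (S : PolySeq E) (j : ℕ) : NormedSpace ℂ (S.Poly j) :=
  NormedSpace.ofCore (S.core j)

/-- An element of `𝒫(ʲE)` that lies in `𝒫_Θ(ʲE)`, as an element of the normed space. -/
def PolySeq.elt (S : PolySeq E) {j : ℕ} (P : E → ℂ) (h : P ∈ S.space j) : S.Poly j := ⟨P, h⟩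

/-- The linear inclusion of `𝒫_Θ(ʲE)` into the functions `E → ℂ`. -/
def PolySeq.toFun (S : PolySeq E) (j : ℕ) : S.Poly j →ₗ[ℂ] (E → ℂ) := (S.space j).subtype

instance (S : PolySeq E) (j : ℕ) : CoeFun (S.Poly j) (fun _ => E → ℂ) := ⟨S.toFun j⟩

end Types

/-- A holomorphy type `Θ` from `E` to `ℂ`. -/
structure HolomorphyType (E : Type*) [NormedAddCommGroup E] [NormedSpace ℂ E]
    extends PolySeq E where
  complete : ∀ j, CompleteSpace (toPolySeq.Poly j)
  const_mem : ∀ c : ℂ, (fun _ : E => c) ∈ space 0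
  norm_const : ∀ c : ℂ, ‖toPolySeq.elt _ (const_mem c)‖ = ‖c‖
  deriv : ∃ σ : ℝ, 1 ≤ σ ∧ ∀ (j k : ℕ), k ≤ j → ∀ (a : E) (P : toPolySeq.Poly j),
    ∃ h : taylorPoly k P a ∈ space k,
      ‖toPolySeq.elt _ h‖ ≤ σ ^ j * ‖P‖ * ‖a‖ ^ (j - k)

namespace HolomorphyType

section

variable {E : Type*} [NormedAddCommGroup E] [NormedSpace ℂ E]

/-- `f` belongs to `ℬ^k_{Θ,ρ}(E)`: `f` is entire, its Taylor polynomials at `0` lie in `Θ`, and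
`‖f‖_{Θ,k,ρ} = ∑ ρ⁻ʲ (j/(ke))^(j/k) ‖(1/j!) d̂ʲf(0)‖_Θ < ∞`. -/
structure MemB (Θ : HolomorphyType E) (k : ℝ≥0∞) (ρ : ℝ) (f : E → ℂ) : Prop where
  entire : Entire f
  mem : ∀ j, taylorPoly j f 0 ∈ Θ.space j
  summable : Summable fun j : ℕ => ρ⁻¹ ^ j * orderWeight k j * ‖Θ.elt _ (mem j)‖

variable {Θ : HolomorphyType E} {k : ℝ≥0∞} {ρ : ℝ} {f g : E → ℂ}

theorem taylorPoly_add (hf : Entire f) (hg : Entire g) (j : ℕ) (a : E) :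
    taylorPoly j (f + g) a = taylorPoly j f a + taylorPoly j g a := by
  simp only [taylorPoly, dhat_add hf hg, smul_add]

theorem taylorPoly_smul (hf : Entire f) (c : ℂ) (j : ℕ) (a : E) :
    taylorPoly j (c • f) a = c • taylorPoly j f a := by
  simp only [taylorPoly, dhat_smul hf, smul_comm c]

theorem MemB.add (hρ : 0 < ρ) (hf : MemB Θ k ρ f) (hg : MemB Θ k ρ g) : MemB Θ k ρ (f + g) := by
  have hm : ∀ j, taylorPoly j (f + g) 0 ∈ Θ.space j := fun j => by
    rw [taylorPoly_add hf.entire hg.entire]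
    exact (Θ.space j).add_mem (hf.mem j) (hg.mem j)
  refine ⟨hf.entire.add hg.entire, hm, ?_⟩
  refine Summable.of_nonneg_of_le (fun j => ?_) (fun j => ?_) (hf.summable.add hg.summable)
  · have := orderWeight_nonneg k j
    positivity
  · have h0 := orderWeight_nonneg k j
    have h1 : Θ.elt _ (hm j) = Θ.elt _ (hf.mem j) + Θ.elt _ (hg.mem j) :=
      Subtype.ext (taylorPoly_add hf.entire hg.entire j 0)
    rw [h1, ← mul_add]
    gcongr
    exact norm_add_le _ _

theorem MemB.smul (hf : MemB Θ k ρ f) (c : ℂ) : MemB Θ k ρ (c • f) := by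
  have hm : ∀ j, taylorPoly j (c • f) 0 ∈ Θ.space j := fun j => by
    rw [taylorPoly_smul hf.entire]
    exact (Θ.space j).smul_mem c (hf.mem j)
  refine ⟨hf.entire.smul c, hm, ?_⟩
  refine (hf.summable.mul_left ‖c‖).congr fun j => ?_
  have h1 : Θ.elt _ (hm j) = c • Θ.elt _ (hf.mem j) :=
    Subtype.ext (taylorPoly_smul hf.entire c j 0)
  rw [h1, norm_smul]
  ring

theorem MemB.zero : MemB Θ k ρ 0 := by
  have h0 : Entire (0 : E → ℂ) := fun x _ => analyticAt_const
  have e : ∀ j, taylorPoly j (0 : E → ℂ) 0 = 0 := fun j => by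
    have := taylorPoly_smul h0 0 j 0
    simpa using this
  have hm : ∀ j, taylorPoly j (0 : E → ℂ) 0 ∈ Θ.space j := fun j => by
    rw [e]; exact (Θ.space j).zero_mem
  refine ⟨h0, hm, ?_⟩
  have h1 : ∀ j, Θ.elt _ (hm j) = 0 := fun j => Subtype.ext (e j)
  simp [h1, summable_zero]

/-- `Exp^k_{Θ,0}(E) = ⋂_{ρ > 0} ℬ^k_{Θ,ρ}(E)` as a vector space of functions. -/
def expSubmodule (Θ : HolomorphyType E) (k : ℝ≥0∞) : Submodule ℂ (E → ℂ) where
  carrier := {f | ∀ ρ : ℝ, 0 < ρ → MemB Θ k ρ f}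
  zero_mem' := fun _ _ => MemB.zero
  add_mem' := fun hf hg ρ hρ => (hf ρ hρ).add hρ (hg ρ hρ)
  smul_mem' := fun c _ hf ρ hρ => (hf ρ hρ).smul c

/-- The space `Exp^k_{Θ,0}(E)`, to be given its projective limit topology. -/
def Exp (Θ : HolomorphyType E) (k : ℝ≥0∞) : Type _ := Θ.expSubmodule k

instance (Θ : HolomorphyType E) (k : ℝ≥0∞) : AddCommGroup (Θ.Exp k) :=
  inferInstanceAs (AddCommGroup (Θ.expSubmodule k))

instance (Θ : HolomorphyType E) (k : ℝ≥0∞) : Module ℂ (Θ.Exp k) :=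
  inferInstanceAs (Module ℂ (Θ.expSubmodule k))

/-- The linear inclusion of `Exp^k_{Θ,0}(E)` into the functions `E → ℂ`. -/
def Exp.toFun (Θ : HolomorphyType E) (k : ℝ≥0∞) : Θ.Exp k →ₗ[ℂ] (E → ℂ) :=
  (Θ.expSubmodule k).subtype

instance (Θ : HolomorphyType E) (k : ℝ≥0∞) : CoeFun (Θ.Exp k) (fun _ => E → ℂ) :=
  ⟨Exp.toFun Θ k⟩

/-- A function in `Exp^k_{Θ,0}(E)`, as an element of that space. -/
def Exp.mk (f : E → ℂ) (hf : f ∈ Θ.expSubmodule k) : Θ.Exp k := ⟨f, hf⟩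

theorem Exp.memB (f : Θ.Exp k) {ρ : ℝ} (hρ : 0 < ρ) : MemB Θ k ρ f := f.2 ρ hρ

/-- `(1 / j!) d̂ʲf(0)` as an element of the normed space `𝒫_Θ(ʲE)`. -/
noncomputable def Exp.coeff (j : ℕ) : Θ.Exp k →ₗ[ℂ] Θ.Poly j where
  toFun f := Θ.elt (taylorPoly j f 0) ((f.memB one_pos).mem j)
  map_add' f g := Subtype.ext
    (taylorPoly_add (f.memB one_pos).entire (g.memB one_pos).entire j 0)
  map_smul' c f := Subtype.ext (taylorPoly_smul (f.memB one_pos).entire c j 0)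

theorem Exp.summable (f : Θ.Exp k) {ρ : ℝ} (hρ : 0 < ρ) :
    Summable fun j : ℕ => ρ⁻¹ ^ j * orderWeight k j * ‖Exp.coeff j f‖ := (f.memB hρ).summable

/-- The norm `‖f‖_{Θ,k,ρ}` (`p^∞_{Θ,ρ}(f)` when `k = ∞`) on `Exp^k_{Θ,0}(E)`. -/
noncomputable def expNorm (Θ : HolomorphyType E) (k : ℝ≥0∞) (ρ : Set.Ioi (0 : ℝ)) :
    Seminorm ℂ (Θ.Exp k) :=
  Seminorm.of (fun f => ∑' j : ℕ, (ρ : ℝ)⁻¹ ^ j * orderWeight k j * ‖Exp.coeff j f‖)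
    (fun f g => by
      rw [← (f.summable ρ.2).tsum_add (g.summable ρ.2)]
      refine Summable.tsum_le_tsum (fun j => ?_) ((f + g).summable ρ.2)
        ((f.summable ρ.2).add (g.summable ρ.2))
      have h0 := orderWeight_nonneg k j
      have h1 : (0 : ℝ) < ρ := ρ.2
      rw [map_add, ← mul_add]
      gcongr
      exact norm_add_le _ _)
    (fun c f => by
      rw [← tsum_mul_left]
      congr 1
      funext j
      rw [map_smul, norm_smul]
      ring)

/-- The locally convex projective limit topology, generated by the norms `‖·‖_{Θ,k,ρ}`, `ρ > 0`. -/
noncomputable instance (Θ : HolomorphyType E) (k : ℝ≥0∞) : TopologicalSpace (Θ.Exp k) :=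
  (SeminormFamily.moduleFilterBasis (Θ.expNorm k)).topology

theorem withSeminorms (Θ : HolomorphyType E) (k : ℝ≥0∞) :
    WithSeminorms (Θ.expNorm k) := ⟨rfl⟩

/-- The conditions that make a holomorphy type a `π₁`-holomorphy type. -/
structure IsPi1 (Θ : HolomorphyType E) : Prop where
  finite_mem : ∀ j, finitePoly E j ≤ Θ.space j
  bound : ∃ K : ℝ, 0 < K ∧ ∀ (j : ℕ) (φ : E →L[ℂ] ℂ) (b : ℂ)
    (h : (fun x => φ x ^ j * b) ∈ Θ.space j), ‖Θ.elt _ h‖ ≤ K ^ j * ‖φ‖ ^ j * ‖b‖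
  dense : ∀ j, Dense {P : Θ.Poly j | (P : E → ℂ) ∈ finitePoly E j}

end

end HolomorphyType
end HoloType
namespace HoloType
namespace HolomorphyType

section Members

variable {E : Type*} [NormedAddCommGroup E] [NormedSpace ℂ E]
variable {Θ : HolomorphyType E} {k : ℝ≥0∞}

theorem poly_mem_exp (k : ℝ≥0∞) {m : ℕ} {P : E → ℂ} (hP : P ∈ Θ.space m) :
    P ∈ Θ.expSubmodule k := by
  intro ρ _
  have hh := Θ.le_homPoly m hP
  have hm : ∀ j, taylorPoly j P 0 ∈ Θ.space j := fun j => by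
    rw [taylorPoly_homPoly_zero hh]
    split_ifs with h
    · subst h; exact hP
    · exact (Θ.space j).zero_mem
  refine ⟨entire_of_homPoly hh, hm, summable_of_ne_finset_zero (s := {m}) fun j hj => ?_⟩
  have h0 : Θ.elt _ (hm j) = 0 := Subtype.ext (by
    change taylorPoly j P 0 = 0
    rw [taylorPoly_homPoly_zero hh, if_neg (by simpa using hj)])
  rw [h0, norm_zero, mul_zero]

theorem IsPi1.pow_mem (h : Θ.IsPi1) (j : ℕ) (φ : E →L[ℂ] ℂ) :
    (fun x => φ x ^ j) ∈ Θ.space j :=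
  h.finite_mem j (Submodule.subset_span ⟨φ, rfl⟩)

theorem exp_mem (h : Θ.IsPi1) (hk : 1 < k) (φ : E →L[ℂ] ℂ) :
    (fun x => Complex.exp (φ x)) ∈ Θ.expSubmodule k := by
  intro ρ hρ
  have hm : ∀ j, taylorPoly j (fun x => Complex.exp (φ x)) 0 ∈ Θ.space j := fun j => by
    rw [taylorPoly_exp]
    exact (Θ.space j).smul_mem _ (h.pow_mem j φ)
  refine ⟨entire_exp φ, hm, ?_⟩
  obtain ⟨K, hK, hb⟩ := h.bound
  refine Summable.of_nonneg_of_le (fun j => ?_) (fun j => ?_)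
    (summable_orderWeight_exp hk (R := ρ⁻¹ * (K * ‖φ‖)) (by positivity))
  · have := orderWeight_nonneg k j
    positivity
  · have h0 := orderWeight_nonneg k j
    have e : (fun x => φ x ^ j * (j.factorial : ℂ)⁻¹) =
        taylorPoly j (fun x => Complex.exp (φ x)) 0 := by
      rw [taylorPoly_exp]; funext x; simp [mul_comm]
    have h1 : (fun x => φ x ^ j * (j.factorial : ℂ)⁻¹) ∈ Θ.space j := by
      rw [e]; exact hm j
    have h2 : Θ.elt _ (hm j) = Θ.elt _ h1 := Subtype.ext e.symm
    rw [h2]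
    have h3 := hb j φ _ h1
    rw [norm_inv, Complex.norm_natCast] at h3
    calc ρ⁻¹ ^ j * orderWeight k j * ‖Θ.elt _ h1‖
        ≤ ρ⁻¹ ^ j * orderWeight k j * (K ^ j * ‖φ‖ ^ j * (j.factorial : ℝ)⁻¹) := by gcongr
      _ = _ := by rw [mul_pow, mul_pow]; ring

theorem norm_apply_le {σ : ℝ}
    (hd : ∀ (j k : ℕ), k ≤ j → ∀ (a : E) (P : Θ.Poly j),
      ∃ h : taylorPoly k P a ∈ Θ.space k, ‖Θ.elt _ h‖ ≤ σ ^ j * ‖P‖ * ‖a‖ ^ (j - k))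
    (n : ℕ) (Q : Θ.Poly n) (y : E) : ‖Q y‖ ≤ σ ^ n * ‖Q‖ * ‖y‖ ^ n := by
  obtain ⟨h, hle⟩ := hd n 0 (Nat.zero_le _) y Q
  have e : taylorPoly 0 Q y = fun _ => Q y := by
    funext x; simp [taylorPoly, dhat]
  have h1 : Θ.elt _ h = Θ.elt _ (Θ.const_mem (Q y)) := Subtype.ext e
  rw [h1, Θ.norm_const] at hle
  simpa using hle

theorem Exp.hasSum (f : Θ.Exp k) (y : E) : HasSum (fun j => Exp.coeff j f y) (f y) := by
  have := (f.memB one_pos).entire.hasSum_line 0 y 1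
  simp only [one_pow, one_mul, one_smul, zero_add] at this
  exact this

theorem Exp.summable_pow_weight (f : Θ.Exp k) {R : ℝ} (hR : 0 ≤ R) :
    Summable fun j : ℕ => R ^ j * orderWeight k j * ‖Exp.coeff j f‖ := by
  have h := f.summable (ρ := (R + 1)⁻¹) (by positivity)
  rw [inv_inv] at h
  refine Summable.of_nonneg_of_le (fun j => ?_) (fun j => ?_) h
  · have := orderWeight_nonneg k j
    positivity
  · have := orderWeight_nonneg k j
    gcongr
    linarith

theorem Exp.summable_pow (hk : 1 ≤ k) (f : Θ.Exp k) {R : ℝ} (hR : 0 ≤ R) :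
    Summable fun j : ℕ => R ^ j * ‖Exp.coeff j f‖ := by
  refine Summable.of_nonneg_of_le (fun j => by positivity) (fun j => ?_)
    ((f.summable_pow_weight hR).mul_left (Real.exp 1))
  have h := mul_le_mul_of_nonneg_left (exp_neg_one_le_orderWeight hk j) (Real.exp_pos 1).le
  rw [← Real.exp_add, add_neg_cancel, Real.exp_zero] at h
  calc R ^ j * ‖Exp.coeff j f‖ = 1 * (R ^ j * ‖Exp.coeff j f‖) := (one_mul _).symm
    _ ≤ (Real.exp 1 * orderWeight k j) * (R ^ j * ‖Exp.coeff j f‖) := by gcongr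
    _ = _ := by ring

/-- Translates of elements of `Exp^k_{Θ,0}(E)` belong to `Exp^k_{Θ,0}(E)`. -/
theorem translate_mem (hk : 1 ≤ k) (f : Θ.Exp k) (a : E) :
    (fun y => f (y + a)) ∈ Θ.expSubmodule k := by
  classical
  have := Θ.complete
  obtain ⟨σ, hσ, hd⟩ := Θ.deriv
  have hσ0 : 0 < σ := by linarith
  have hfE : Entire f := (f.memB one_pos).entire
  set p : ∀ j, Θ.Poly j := fun j => Exp.coeff j f with hp
  have hpE : ∀ j, (p j : E → ℂ) ∈ homPoly E j := fun j => Θ.le_homPoly j (p j).2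
  set A : ℝ := ‖a‖ + 1 with hA
  have hA1 : 1 ≤ A := by have := norm_nonneg a; linarith
  let Q : ∀ n, ℕ → Θ.Poly n := fun n j =>
    if h : n ≤ j then Θ.elt _ (hd j n h a (p j)).choose else 0
  have Qapp : ∀ n j y, Q n j y = taylorPoly n (p j) a y := by
    intro n j y
    by_cases h : n ≤ j
    · simp only [Q, dif_pos h]; rfl
    · simp only [Q, dif_neg h]
      rw [taylorPoly_homPoly_of_lt (by omega) (hpE j), map_zero]
  have Qnorm : ∀ c : ℝ, 0 ≤ c → ∀ n j, c ^ n * ‖Q n j‖ ≤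
      (σ * A * (2 * (c + 1))) ^ j * ‖p j‖ * (1 / 2) ^ n := by
    intro c hc n j
    by_cases h : n ≤ j
    · have h1 : ‖Q n j‖ ≤ σ ^ j * ‖p j‖ * A ^ j := by
        simp only [Q, dif_pos h]
        refine (hd j n h a (p j)).choose_spec.trans ?_
        gcongr
        calc ‖a‖ ^ (j - n) ≤ A ^ (j - n) := by gcongr; linarith
          _ ≤ A ^ j := pow_le_pow_right₀ hA1 (by omega)
      have h2 : c ^ n ≤ (2 * (c + 1)) ^ j * (1 / 2) ^ n := by
        calc c ^ n ≤ (c + 1) ^ n := by gcongr; linarith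
          _ = (2 * (c + 1)) ^ n * (1 / 2) ^ n := by rw [← mul_pow]; congr 1; ring
          _ ≤ _ := by gcongr; · linarith
      calc c ^ n * ‖Q n j‖ ≤ ((2 * (c + 1)) ^ j * (1 / 2) ^ n) * (σ ^ j * ‖p j‖ * A ^ j) := by
            gcongr
        _ = _ := by rw [mul_pow (σ * A), mul_pow σ]; ring
    · simp only [Q, dif_neg h, norm_zero, mul_zero]
      positivity
  have hgeo : Summable fun n : ℕ => ((1 : ℝ) / 2) ^ n :=
    summable_geometric_of_lt_one (by norm_num) (by norm_num)
  have Qsum' : ∀ n, Summable fun j => ‖Q n j‖ := by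
    intro n
    refine Summable.of_nonneg_of_le (fun j => norm_nonneg _) (fun j => ?_)
      ((f.summable_pow hk (R := σ * A * (2 * (1 + 1))) (by positivity)).mul_right ((1 / 2) ^ n))
    simpa using Qnorm 1 zero_le_one n j
  have Qsum : ∀ n, Summable (Q n) := fun n => (Qsum' n).of_norm
  let S : ∀ n, Θ.Poly n := fun n => ∑' j, Q n j
  have Sapp : ∀ n y, HasSum (fun j => taylorPoly n (p j) a y) (S n y) := by
    intro n y
    let ev : Θ.Poly n →L[ℂ] ℂ := LinearMap.mkContinuous
      ((LinearMap.proj y).comp (Θ.toFun n)) (σ ^ n * ‖y‖ ^ n) (fun Q => by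
        refine (norm_apply_le hd n Q y).trans (le_of_eq ?_); ring)
    have := (Qsum n).hasSum.mapL ev
    have e : ∀ j, ev (Q n j) = taylorPoly n (p j) a y := fun j => Qapp n j y
    simp only [e] at this
    exact this
  have Shas : ∀ (y : E) (t : ℂ), HasSum (fun n => t ^ n * S n y) (f (a + t • y)) := by
    intro y t
    let F : ℕ × ℕ → ℂ := fun q => t ^ q.1 * taylorPoly q.1 (p q.2) a y
    have hF : Summable F := by
      set c : ℝ := ‖t‖ * σ * ‖y‖ with hc
      have hc0 : 0 ≤ c := by positivity
      have hprod := Summable.mul_of_nonneg hgeo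
        (f.summable_pow hk (R := σ * A * (2 * (c + 1))) (by positivity))
        (fun n => by positivity) (fun j => by positivity)
      refine Summable.of_norm_bounded hprod fun q => ?_
      rcases q with ⟨n, j⟩
      simp only [F, norm_mul, norm_pow]
      rw [← Qapp]
      calc ‖t‖ ^ n * ‖Q n j y‖ ≤ ‖t‖ ^ n * (σ ^ n * ‖Q n j‖ * ‖y‖ ^ n) := by
            gcongr; exact norm_apply_le hd n _ y
        _ = c ^ n * ‖Q n j‖ := by rw [hc, mul_pow, mul_pow]; ring
        _ ≤ _ := Qnorm c hc0 n j
        _ = _ := by ring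
    have h1 := hF.hasSum.prod_fiberwise (fun n => (Sapp n y).mul_left (t ^ n))
    have h2 := ((Equiv.prodComm ℕ ℕ).hasSum_iff.2 hF.hasSum).prod_fiberwise
      (fun j => (entire_of_homPoly (hpE j)).hasSum_line a y t)
    rw [(f.hasSum (a + t • y)).unique h2]
    exact h1
  have hEt : Entire (fun y => f (y + a)) := hfE.translate a
  have hT : ∀ n, taylorPoly n (fun y => f (y + a)) 0 = S n := by
    intro n
    funext y
    refine dhat_of_hasSum hEt (c := fun n => S n y) (fun t => ?_) n
    have := Shas y t
    rwa [add_comm a, ← zero_add (t • y)] at this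
  have hm : ∀ n, taylorPoly n (fun y => f (y + a)) 0 ∈ Θ.space n := fun n => by
    rw [hT]; exact (S n).2
  intro ρ hρ
  refine ⟨hEt, hm, ?_⟩
  set c : ℝ := ρ⁻¹ with hc
  have hc0 : 0 ≤ c := by positivity
  set R : ℝ := σ * A * (2 * (c + 1)) with hR
  have hW := f.summable_pow_weight (R := R) (by positivity)
  refine Summable.of_nonneg_of_le (fun n => ?_) (fun n => ?_)
    (hgeo.mul_left (Real.exp 1 * ∑' j : ℕ, R ^ j * orderWeight k j * ‖p j‖))
  · have := orderWeight_nonneg k n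
    positivity
  · have h0 := orderWeight_nonneg k n
    have h1 : Θ.elt _ (hm n) = S n := Subtype.ext (hT n)
    rw [h1]
    calc c ^ n * orderWeight k n * ‖S n‖
        ≤ c ^ n * orderWeight k n * ∑' j, ‖Q n j‖ := by
          gcongr; exact norm_tsum_le_tsum_norm (Qsum' n)
      _ = ∑' j, c ^ n * orderWeight k n * ‖Q n j‖ := by rw [tsum_mul_left]
      _ ≤ ∑' j, Real.exp 1 * (R ^ j * orderWeight k j * ‖p j‖) * (1 / 2) ^ n := by
          refine Summable.tsum_le_tsum (fun j => ?_) ((Qsum' n).mul_left _)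
            ((hW.mul_left _).mul_right _)
          by_cases h : n ≤ j
          · calc c ^ n * orderWeight k n * ‖Q n j‖ = orderWeight k n * (c ^ n * ‖Q n j‖) := by ring
              _ ≤ (Real.exp 1 * orderWeight k j) * (R ^ j * ‖p j‖ * (1 / 2) ^ n) := by
                  have := orderWeight_nonneg k j
                  exact mul_le_mul (orderWeight_le hk h) (Qnorm c hc0 n j) (by positivity)
                    (by positivity)
              _ = _ := by ring
          · simp only [Q, dif_neg h, norm_zero, mul_zero]
            have := orderWeight_nonneg k j
            positivity
      _ = _ := by rw [tsum_mul_right, tsum_mul_left]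

end Members
end HolomorphyType
end HoloType
namespace HoloType
namespace HolomorphyType

section Operators

variable {E : Type*} [NormedAddCommGroup E] [NormedSpace ℂ E]
variable {Θ : HolomorphyType E} {k : ℝ≥0∞}

/-- For `k = ∞` the space `Exp^∞_{Θ,0}(E)` consists of the entire functions with Taylor polynomials
in `Θ` and `limsup ‖(1/j!) d̂ʲf(0)‖_Θ^(1/j) ≤ 0`. -/
theorem mem_exp_top_iff {f : E → ℂ} :
    f ∈ Θ.expSubmodule ⊤ ↔ Entire f ∧ ∃ h : ∀ j, taylorPoly j f 0 ∈ Θ.space j,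
      Filter.limsup (fun j : ℕ => ENNReal.ofReal (‖Θ.elt _ (h j)‖ ^ ((j : ℝ)⁻¹)))
        Filter.atTop ≤ 0 := by
  constructor
  · intro hf
    refine ⟨(hf 1 one_pos).entire, (hf 1 one_pos).mem, ?_⟩
    refine le_of_forall_gt fun ε hε => ?_
    obtain ⟨δ, hδ, hδε⟩ : ∃ δ : ℝ, 0 < δ ∧ ENNReal.ofReal δ < ε := by
      obtain ⟨r, hr0, hr⟩ := ENNReal.lt_iff_exists_nnreal_btwn.1 hε
      exact ⟨r, by exact_mod_cast hr0, by simpa using hr⟩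
    refine lt_of_le_of_lt ?_ hδε
    have hs := (hf δ hδ).summable.tendsto_atTop_zero
    have hev := hs.eventually (gt_mem_nhds one_pos)
    refine Filter.limsup_le_of_le (by isBoundedDefault) ?_
    filter_upwards [hev, Filter.eventually_gt_atTop 0] with j hj hj0
    refine ENNReal.ofReal_le_ofReal ?_
    have hj' : (0 : ℝ) < j := by exact_mod_cast hj0
    rw [Real.rpow_inv_le_iff_of_pos (norm_nonneg _) hδ.le hj', Real.rpow_natCast]
    simp only [orderWeight, if_true, mul_one] at hj
    rw [inv_pow, inv_mul_lt_iff₀ (by positivity)] at hj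
    linarith
  · rintro ⟨hE, hm, hlim⟩ ρ hρ
    refine ⟨hE, hm, ?_⟩
    have hlt : Filter.limsup (fun j : ℕ => ENNReal.ofReal (‖Θ.elt _ (hm j)‖ ^ ((j : ℝ)⁻¹)))
        Filter.atTop < ENNReal.ofReal (ρ / 2) :=
      lt_of_le_of_lt hlim (by simpa using hρ)
    have hev := Filter.eventually_lt_of_limsup_lt hlt
    refine Summable.of_norm_bounded_eventually_nat
      (summable_geometric_of_lt_one (r := (1 : ℝ) / 2) (by norm_num) (by norm_num)) ?_
    filter_upwards [hev, Filter.eventually_gt_atTop 0] with j hj hj0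
    have hj' : (0 : ℝ) < j := by exact_mod_cast hj0
    have h1 := (ENNReal.ofReal_lt_ofReal_iff (by positivity)).1 hj
    have h2 := (Real.rpow_inv_le_iff_of_pos (norm_nonneg _) (by positivity) hj').1 h1.le
    rw [Real.rpow_natCast] at h2
    simp only [orderWeight, if_true, mul_one]
    rw [Real.norm_of_nonneg (by positivity)]
    calc ρ⁻¹ ^ j * ‖Θ.elt _ (hm j)‖ ≤ ρ⁻¹ ^ j * (ρ / 2) ^ j := by gcongr
      _ = (1 / 2) ^ j := by rw [← mul_pow]; congr 1; field_simp

/-- The translate `τ_{-x} f : y ↦ f (y + x)`. -/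
def translate (hk : 1 ≤ k) (x : E) (f : Θ.Exp k) : Θ.Exp k :=
  Exp.mk (fun y => f (y + x)) (translate_mem hk f x)

/-- The convolution product `(T ∗ f)(x) = T (τ_{-x} f)`. -/
noncomputable def conv (hk : 1 ≤ k) (T : Θ.Exp k →L[ℂ] ℂ) (f : Θ.Exp k) : E → ℂ :=
  fun x => T (translate hk x f)

/-- The exponential `e^φ` as an element of `Exp^k_{Θ,0}(E)`. -/
noncomputable def expFun (h : Θ.IsPi1) (hk : 1 < k) (φ : E →L[ℂ] ℂ) : Θ.Exp k :=
  Exp.mk (fun x => Complex.exp (φ x)) (exp_mem h hk φ)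

/-- The Fourier-Borel transform `𝓕T(φ) = T (e^φ)`. -/
noncomputable def fourierBorel (h : Θ.IsPi1) (hk : 1 < k) (T : Θ.Exp k →L[ℂ] ℂ) :
    (E →L[ℂ] ℂ) → ℂ :=
  fun φ => T (expFun h hk φ)

theorem mixed_mem (Θ : HolomorphyType E) {j m : ℕ} (hm : m ≤ j) (P : Θ.Poly j)
    {B : ContinuousMultilinearMap ℂ (fun _ : Fin j => E) ℂ}
    (hsymm : ∀ (τ : Equiv.Perm (Fin j)) (v : Fin j → E), B (fun i => v (τ i)) = B v)
    (hB : ∀ x, P x = B (fun _ => x)) (y : E) :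
    (fun x => B (mixed m x y)) ∈ Θ.space m := by
  rw [mixed_eq_taylorPoly hm hsymm hB]
  obtain ⟨σ, _, hd⟩ := Θ.deriv
  exact (Θ.space m).smul_mem _ (hd j m hm y P).choose

/-- The function `T(B̂·ᵐ) : y ↦ T (x ↦ B(x, …, x, y, …, y))`, with `x` taken `m` times and `y` taken
`j - m` times, where `B` is the symmetric `j`-linear map of `P ∈ 𝒫_Θ(ʲE)`. -/
noncomputable def contract (T : Θ.Exp k →L[ℂ] ℂ) {j m : ℕ} (hm : m ≤ j) (P : Θ.Poly j)
    (B : ContinuousMultilinearMap ℂ (fun _ : Fin j => E) ℂ)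
    (hsymm : ∀ (τ : Equiv.Perm (Fin j)) (v : Fin j → E), B (fun i => v (τ i)) = B v)
    (hB : ∀ x, P x = B (fun _ => x)) : E → ℂ :=
  fun y => T (Exp.mk (fun x => B (mixed m x y)) (poly_mem_exp k (mixed_mem Θ hm P hsymm hB y)))

/-- The conditions that make a holomorphy type a `π_{2,k}`-holomorphy type (with `A = 0`). -/
structure IsPi2 (Θ : HolomorphyType E) (k : ℝ≥0∞) : Prop where
  mem : ∀ (T : Θ.Exp k →L[ℂ] ℂ) (j m : ℕ) (hm : m ≤ j) (P : Θ.Poly j)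
    (B : ContinuousMultilinearMap ℂ (fun _ : Fin j => E) ℂ)
    (hsymm : ∀ (τ : Equiv.Perm (Fin j)) (v : Fin j → E), B (fun i => v (τ i)) = B v)
    (hB : ∀ x, P x = B (fun _ => x)), contract T hm P B hsymm hB ∈ Θ.space (j - m)
  bound : ∀ (T : Θ.Exp k →L[ℂ] ℂ) (C : ℝ) (ρ : Set.Ioi (0 : ℝ)), 0 < C →
    (∀ f, ‖T f‖ ≤ C * Θ.expNorm k ρ f) →
    ∃ M : ℝ, 0 < M ∧ ∀ (j m : ℕ) (hm : m ≤ j) (P : Θ.Poly j)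
      (B : ContinuousMultilinearMap ℂ (fun _ : Fin j => E) ℂ)
      (hsymm : ∀ (τ : Equiv.Perm (Fin j)) (v : Fin j → E), B (fun i => v (τ i)) = B v)
      (hB : ∀ x, P x = B (fun _ => x)),
      ‖Θ.elt _ (mem T j m hm P B hsymm hB)‖ ≤
        C * M ^ j * (ρ : ℝ)⁻¹ ^ m * orderWeight k m * ‖P‖

/-- The Borel transform `ℬ_Θ T(φ) = T (φᵐ)` on `[𝒫_Θ(ᵐE)]'`. -/
noncomputable def borel (h : Θ.IsPi1) (m : ℕ) : (Θ.Poly m →L[ℂ] ℂ) →ₗ[ℂ] ((E →L[ℂ] ℂ) → ℂ) where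
  toFun T := fun φ => T (Θ.elt _ (h.pow_mem m φ))
  map_add' _ _ := rfl
  map_smul' _ _ := rfl

theorem borel_injective (h : Θ.IsPi1) (m : ℕ) : Function.Injective (borel h m) := by
  intro S T hST
  have key : ∀ (Q : E → ℂ), Q ∈ finitePoly E m → ∀ hQ : Q ∈ Θ.space m,
      S (Θ.elt Q hQ) = T (Θ.elt Q hQ) := by
    intro Q hQf
    refine Submodule.span_induction (p := fun Q _ => ∀ hQ : Q ∈ Θ.space m,
      S (Θ.elt Q hQ) = T (Θ.elt Q hQ)) ?_ ?_ ?_ ?_ hQf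
    · rintro _ ⟨φ, rfl⟩ hQ
      exact congrFun hST φ
    · intro hQ
      have : Θ.elt (0 : E → ℂ) hQ = 0 := rfl
      rw [this, map_zero, map_zero]
    · intro P Q hP hQ hP' hQ' hPQ
      have h1 := h.finite_mem m hP
      have h2 := h.finite_mem m hQ
      have : Θ.elt (P + Q) hPQ = Θ.elt P h1 + Θ.elt Q h2 := rfl
      rw [this, map_add, map_add, hP' h1, hQ' h2]
    · intro c P hP hP' hcP
      have h1 := h.finite_mem m hP
      have : Θ.elt (c • P) hcP = c • Θ.elt P h1 := rfl
      rw [this, map_smul, map_smul, hP' h1]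
  exact DFunLike.coe_injective
    (Continuous.ext_on (h.dense m) S.continuous T.continuous fun P hP => key P hP P.2)

/-- The space `𝒫_{Θ'}(ᵐE')`, the range of the Borel transform. -/
noncomputable def dualSpace (h : Θ.IsPi1) (m : ℕ) : Submodule ℂ ((E →L[ℂ] ℂ) → ℂ) := LinearMap.range (borel h m)

/-- The norm of `𝒫_{Θ'}(ᵐE')`: `‖ℬ_Θ T‖_{Θ'} = ‖T‖`. -/
noncomputable def dualNorm (h : Θ.IsPi1) (m : ℕ) (Q : dualSpace h m) : ℝ :=
  ‖(LinearEquiv.ofInjective (borel h m) (borel_injective h m)).symm Q‖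

/-- `f` belongs to `ℬ^k_{Θ',ρ}(E')`, where `k < ∞`. -/
structure MemDualB (h : Θ.IsPi1) (k : ℝ≥0∞) (ρ : ℝ) (f : (E →L[ℂ] ℂ) → ℂ) : Prop where
  entire : Entire f
  mem : ∀ j, taylorPoly j f 0 ∈ dualSpace h j
  summable : Summable fun j : ℕ => ρ⁻¹ ^ j * orderWeight k j * dualNorm h j ⟨_, mem j⟩

/-- `Exp^k_{Θ'}(E') = Exp^k_{Θ',∞}(E') = ⋃_{ρ > 0} ℬ^k_{Θ',ρ}(E')`, where `k < ∞`. -/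
def ExpDual (h : Θ.IsPi1) (k : ℝ≥0∞) : Set ((E →L[ℂ] ℂ) → ℂ) :=
  {f | ∃ ρ : ℝ, 0 < ρ ∧ MemDualB h k ρ f}

end Operators

end HolomorphyType

/-- A collection `𝓕` of entire functions on `V` is closed under division: `f / g` belongs to `𝓕`
whenever `f, g ∈ 𝓕`, `g ≠ 0` and the quotient is entire. -/
def ClosedUnderDivision {V : Type*} [NormedAddCommGroup V] [NormedSpace ℂ V]
    (F : Set (V → ℂ)) : Prop :=
  ∀ f ∈ F, ∀ g ∈ F, g ≠ 0 → ∀ h : V → ℂ, Entire h → (∀ x, f x = h x * g x) → h ∈ F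

end HoloType

/-! Closure under division reduces the claim to finding an entire quotient of `𝓕T₁` by `𝓕T₂`, once
both transforms are known to lie in `Exp^{k'}_{Θ'}(E')` (`fourierBorel_mem_expDual`) and `𝓕T₂` is
known not to vanish identically (`exists_fourierBorel_ne_zero`).

The kernel hypothesis gives divisibility on complex lines. The `j`-th derivative of `t ↦ 𝓕T(χ + tψ)`
is `T(ψʲ e^(χ + tψ))` (`iteratedDeriv_fourierBorel_line`). If `𝓕T₂` vanishes to order at least `n`
at `t` along the line, then `T₂` kills `ψⁱ e^(χ + tψ)` for `i < n`. A translate of such a function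
is a combination of those with smaller or equal `i`, so `T₂` convolved with each of them is zero,
hence `T₁` kills them too. Thus `𝓕T₁` vanishes to at least the same order
(`analyticOrderAt_fourierBorel_line_le`), and one-variable division applies on every line where
`𝓕T₂` is not identically zero.

Passing from lines to `E'` is a Cauchy-type argument (`exists_entire_quotient_of_lines`). Near a
point, choose a direction `v` and a circle on which the denominator `g` has no zeros. By the mean
value property the quotient at `x` is the average of `f / g` over the circle `x + s v`, which is
analytic in `x`. This is shown in the Banach algebra of continuous functions on the circle, using
power series of infinite radius. These local quotients agree because the zero set of `g` has empty
interior. -/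

/-! ### The polarization identity. -/

/-- After complementation the sum runs over all subsets of the complement of the image of `f`. Such
an alternating sum vanishes unless that complement is empty, that is, unless `f` is surjective. -/
theorem sum_neg_one_pow_filter_forall_mem {n : ℕ} {R : Type*} [CommRing R] (f : Fin n → Fin n) :
    ∑ s : Finset (Fin n) with ∀ j, f j ∈ s, (-1 : R) ^ sᶜ.card =
      if Function.Bijective f then 1 else 0 := by
  classical
  have h1 : ∑ s : Finset (Fin n) with ∀ j, f j ∈ s, (-1 : ℤ) ^ sᶜ.card =
      ∑ t ∈ (Finset.univ.image f)ᶜ.powerset, (-1 : ℤ) ^ t.card := by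
    refine Finset.sum_nbij' (fun s => sᶜ) (fun s => sᶜ) ?_ ?_ ?_ ?_ ?_
    · intro s hs
      simp only [Finset.mem_filter, Finset.mem_univ, true_and] at hs
      rw [Finset.mem_powerset, Finset.compl_subset_compl]
      intro x hx
      obtain ⟨j, -, rfl⟩ := Finset.mem_image.1 hx
      exact hs j
    · intro t ht
      simp only [Finset.mem_filter, Finset.mem_univ, true_and, Finset.mem_compl]
      intro j hj
      exact Finset.mem_compl.1 (Finset.mem_powerset.1 ht hj)
        (Finset.mem_image_of_mem f (Finset.mem_univ j))
    · intro s _; simp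
    · intro s _; simp
    · intro s _; rfl
  have h2 : ((Finset.univ.image f)ᶜ = ∅) ↔ Function.Bijective f := by
    rw [Finset.compl_eq_empty_iff, ← Finite.surjective_iff_bijective, Finset.eq_univ_iff_forall]
    simp [Function.Surjective]
  rw [Finset.sum_powerset_neg_one_pow_card] at h1
  simp only [h2] at h1
  have := congrArg (Int.cast : ℤ → R) h1
  push_cast at this
  exact this

/-- **Polarization identity** for a product of `n` elements of a commutative ring. -/
theorem factorial_mul_prod_eq_sum_pow {n : ℕ} {R : Type*} [CommRing R] (a : Fin n → R) :
    (n.factorial : R) * ∏ i, a i =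
      ∑ s : Finset (Fin n), (-1) ^ sᶜ.card * (∑ i ∈ s, a i) ^ n := by
  classical
  -- Each power is expanded over maps `f` of the index set. After the sums are exchanged,
  -- inclusion-exclusion leaves only the `n!` permutations, each contributing the full product.
  have h1 : ∀ s : Finset (Fin n), (∑ i ∈ s, a i) ^ n =
      ∑ f : Fin n → Fin n, if ∀ j, f j ∈ s then ∏ j, a (f j) else 0 := by
    intro s
    rw [Finset.sum_pow', ← Finset.sum_filter]
    refine Finset.sum_congr ?_ fun _ _ => rfl
    ext f; simp
  simp only [h1, Finset.mul_sum]
  rw [Finset.sum_comm]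
  have h2 : ∀ f : Fin n → Fin n, ∑ s : Finset (Fin n),
      (-1 : R) ^ sᶜ.card * (if ∀ j, f j ∈ s then ∏ j, a (f j) else 0) =
      if Function.Bijective f then ∏ j, a j else 0 := by
    intro f
    have := sum_neg_one_pow_filter_forall_mem (R := R) f
    simp only [mul_ite, mul_zero]
    rw [← Finset.sum_filter, ← Finset.sum_mul, this]
    split_ifs with hf
    · rw [one_mul, hf.prod_comp]
    · rw [zero_mul]
  simp only [h2]
  rw [← Finset.sum_filter, Finset.sum_const, nsmul_eq_mul]
  congr 2
  rw [← Fintype.card_subtype, ← Fintype.card_congr (Equiv.ofBijective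
    (fun σ : Equiv.Perm (Fin n) => (⟨σ, σ.bijective⟩ : {f : Fin n → Fin n // Function.Bijective f}))
    ⟨fun σ τ h => DFunLike.coe_injective (Subtype.ext_iff.1 h),
      fun f => ⟨Equiv.ofBijective f.1 f.2, rfl⟩⟩), Fintype.card_perm, Fintype.card_fin]

/-! ### Products of linear functionals in `𝒫_Θ(ⁿE)`. -/

namespace HoloType
namespace HolomorphyType

variable {E : Type*} [NormedAddCommGroup E] [NormedSpace ℂ E] {Θ : HolomorphyType E}

theorem prod_eq_polarization {n : ℕ} (φ : Fin n → E →L[ℂ] ℂ) :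
    (fun x => ∏ i, φ i x) = (n.factorial : ℂ)⁻¹ • ∑ s : Finset (Fin n),
      (-1 : ℂ) ^ sᶜ.card • fun x => (∑ i ∈ s, φ i) x ^ n := by
  funext x
  have h := factorial_mul_prod_eq_sum_pow fun i => φ i x
  have hn : (n.factorial : ℂ) ≠ 0 := by exact_mod_cast n.factorial_ne_zero
  rw [Pi.smul_apply, Finset.sum_apply, smul_eq_mul, eq_inv_mul_iff_mul_eq₀ hn, h]
  refine Finset.sum_congr rfl fun s _ => ?_
  simp

theorem IsPi1.prod_mem (h : Θ.IsPi1) {n : ℕ} (φ : Fin n → E →L[ℂ] ℂ) :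
    (fun x => ∏ i, φ i x) ∈ Θ.space n := by
  rw [prod_eq_polarization]
  exact Submodule.smul_mem _ _ (Submodule.sum_mem _ fun s _ =>
    Submodule.smul_mem _ _ (h.pow_mem n _))

theorem IsPi1.norm_pow_le (h : Θ.IsPi1) : ∃ K : ℝ, 0 < K ∧ ∀ (n : ℕ) (φ : E →L[ℂ] ℂ),
    ‖Θ.elt _ (h.pow_mem n φ)‖ ≤ K ^ n * ‖φ‖ ^ n := by
  obtain ⟨K, hK, hb⟩ := h.bound
  refine ⟨K, hK, fun n φ => ?_⟩
  have e : (fun x => φ x ^ n) = fun x => φ x ^ n * (1 : ℂ) := by simp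
  have h1 : (fun x => φ x ^ n * (1 : ℂ)) ∈ Θ.space n := by rw [← e]; exact h.pow_mem n φ
  have h2 : Θ.elt _ (h.pow_mem n φ) = Θ.elt _ h1 := Subtype.ext e
  rw [h2]
  simpa using hb n φ 1 h1

/-- Polarization writes the product as `1 / n!` times `2ⁿ` signed powers of functionals of norm at
most `n`, each of `Θ`-norm at most `Kⁿ nⁿ`. The bound follows from `nⁿ / n! ≤ eⁿ`. -/
theorem IsPi1.norm_prod_le_of_le_one (h : Θ.IsPi1) {K : ℝ} (hK : 0 < K)
    (hb : ∀ (n : ℕ) (φ : E →L[ℂ] ℂ), ‖Θ.elt _ (h.pow_mem n φ)‖ ≤ K ^ n * ‖φ‖ ^ n)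
    {n : ℕ} (φ : Fin n → E →L[ℂ] ℂ) (hφ : ∀ i, ‖φ i‖ ≤ 1) :
    ‖Θ.elt _ (h.prod_mem φ)‖ ≤ (2 * K * Real.exp 1) ^ n := by
  have e : Θ.elt _ (h.prod_mem φ) = (n.factorial : ℂ)⁻¹ • ∑ s : Finset (Fin n),
      (-1 : ℂ) ^ sᶜ.card • Θ.elt _ (h.pow_mem n (∑ i ∈ s, φ i)) := by
    have hinj : Function.Injective (Θ.toFun n) := Subtype.val_injective
    apply hinj
    rw [map_smul, map_sum]
    simp only [map_smul]
    exact prod_eq_polarization φ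
  have hs : ∀ s : Finset (Fin n), ‖∑ i ∈ s, φ i‖ ≤ n := by
    intro s
    refine (norm_sum_le_of_le s fun i _ => hφ i).trans ?_
    have := Finset.card_le_univ s
    rw [Fintype.card_fin] at this
    simpa using this
  have hfac : (0 : ℝ) < n.factorial := by positivity
  have hexp := Real.pow_div_factorial_le_exp (n : ℝ) (by positivity) n
  rw [e, norm_smul, norm_inv, Complex.norm_natCast]
  calc (n.factorial : ℝ)⁻¹ * ‖∑ s : Finset (Fin n),
      (-1 : ℂ) ^ sᶜ.card • Θ.elt _ (h.pow_mem n (∑ i ∈ s, φ i))‖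
      ≤ (n.factorial : ℝ)⁻¹ * ∑ s : Finset (Fin n), K ^ n * (n : ℝ) ^ n := by
        gcongr
        refine norm_sum_le_of_le _ fun s _ => ?_
        rw [norm_smul]
        simp only [norm_pow, norm_neg, norm_one, one_pow, one_mul]
        refine (hb n _).trans ?_
        gcongr
        exact hs s
    _ = (2 * K) ^ n * ((n : ℝ) ^ n / n.factorial) := by
        rw [Finset.sum_const, Finset.card_univ, Fintype.card_finset, Fintype.card_fin, nsmul_eq_mul,
          mul_pow]
        push_cast
        ring
    _ ≤ (2 * K) ^ n * Real.exp 1 ^ n := by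
        gcongr
        rwa [← Real.exp_nat_mul, mul_one]
    _ = _ := by rw [← mul_pow]

/-- The multilinear map `(φ₁, …, φₙ) ↦ φ₁ ⋯ φₙ` into `𝒫_Θ(ⁿE)`. -/
noncomputable def IsPi1.prodMultilinear (h : Θ.IsPi1) (n : ℕ) :
    MultilinearMap ℂ (fun _ : Fin n => E →L[ℂ] ℂ) (Θ.Poly n) where
  toFun φ := Θ.elt _ (h.prod_mem φ)
  map_update_add' φ i a b := by
    refine Subtype.ext (funext fun x => ?_)
    have := ((MultilinearMap.mkPiAlgebra ℂ (Fin n) ℂ).compLinearMap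
      fun _ => (ContinuousLinearMap.apply ℂ ℂ x).toLinearMap).map_update_add φ i a b
    exact this
  map_update_smul' φ i c a := by
    refine Subtype.ext (funext fun x => ?_)
    have := ((MultilinearMap.mkPiAlgebra ℂ (Fin n) ℂ).compLinearMap
      fun _ => (ContinuousLinearMap.apply ℂ ℂ x).toLinearMap).map_update_smul φ i c a
    exact this

/-- Multilinearity reduces this to functionals of norm at most one. That `A` is independent of `n`
and enters only as `Aⁿ` is what keeps the later series convergent everywhere. -/
theorem IsPi1.norm_prodMultilinear_le (h : Θ.IsPi1) : ∃ A : ℝ, 0 < A ∧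
    ∀ (n : ℕ) (φ : Fin n → E →L[ℂ] ℂ), ‖h.prodMultilinear n φ‖ ≤ A ^ n * ∏ i, ‖φ i‖ := by
  obtain ⟨K, hK, hb⟩ := h.norm_pow_le
  refine ⟨2 * K * Real.exp 1, by positivity, fun n φ => ?_⟩
  -- The normalization also holds for a zero functional, since then both sides are zero.
  have e : φ = fun i => (‖φ i‖ : ℂ) • ((‖φ i‖ : ℂ)⁻¹ • φ i) := by
    funext i
    by_cases hi : φ i = 0
    · ext x; simp [hi]
    · rw [smul_inv_smul₀]
      simpa using hi
  have h1 : ∀ i, ‖(‖φ i‖ : ℂ)⁻¹ • φ i‖ ≤ 1 := by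
    intro i
    rw [norm_smul, norm_inv, Complex.norm_real, norm_norm]
    exact inv_mul_le_one
  have h2 : ‖h.prodMultilinear n fun i => (‖φ i‖ : ℂ)⁻¹ • φ i‖ ≤ _ :=
    h.norm_prod_le_of_le_one hK hb _ h1
  conv_lhs => rw [e]
  rw [MultilinearMap.map_smul_univ, norm_smul, norm_prod, mul_comm]
  simp only [Complex.norm_real, norm_norm]
  gcongr

end HolomorphyType
end HoloType

/-! ### Duality of the weights for conjugate exponents. -/

namespace HoloType

/-- Dropping the factors `k` and `k'` from the bases leaves two powers of `n / e` whose exponents `n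
/ k` and `n / k'` add up to `n`, and `(n / e)ⁿ ≤ n!`. -/
theorem orderWeight_conjExponent_mul_le {k : ℝ≥0∞} (hk : 1 < k) (n : ℕ) :
    orderWeight (ENNReal.conjExponent k) n * orderWeight k n ≤ n.factorial := by
  have hpow : ((n : ℝ) / Real.exp 1) ^ n ≤ n.factorial := by
    have := Real.pow_div_factorial_le_exp (n : ℝ) (by positivity) n
    rw [div_pow, ← Real.exp_nat_mul, mul_one, div_le_iff₀ (Real.exp_pos _)]
    rw [div_le_iff₀ (by positivity)] at this
    linarith
  by_cases hk' : k = ⊤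
  · simpa [hk', ENNReal.conjExponent, orderWeight] using hpow
  have := ENNReal.HolderConjugate.conjExponent hk.le
  have hk'' : ENNReal.conjExponent k ≠ ⊤ := by
    simpa [ENNReal.conjExponent, tsub_eq_zero_iff_le] using hk
  have hc := ENNReal.HolderConjugate.toReal_of_ne_top hk' hk''
  have hp := hc.lt
  have hq := hc.symm.lt
  rw [orderWeight, orderWeight, if_neg hk', if_neg hk'']
  set p := k.toReal
  set q := (ENNReal.conjExponent k).toReal
  have he := Real.exp_pos 1
  have hle : ∀ r : ℝ, 1 < r →
      ((n : ℝ) / (r * Real.exp 1)) ^ ((n : ℝ) / r) ≤ ((n : ℝ) / Real.exp 1) ^ ((n : ℝ) * r⁻¹) := by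
    intro r hr
    rw [← div_eq_mul_inv]
    refine Real.rpow_le_rpow (by positivity) ?_ (by positivity)
    gcongr
    nlinarith
  refine le_trans ?_ hpow
  calc _ ≤ ((n : ℝ) / Real.exp 1) ^ ((n : ℝ) * q⁻¹) * ((n : ℝ) / Real.exp 1) ^ ((n : ℝ) * p⁻¹) :=
        mul_le_mul (hle q hq) (hle p hp) (by positivity) (by positivity)
    _ = _ := by
        rw [← Real.rpow_add_of_nonneg (by positivity) (by positivity) (by positivity), ← mul_add,
          hc.symm.inv_add_inv_eq_one, mul_one, Real.rpow_natCast]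

/-! ### Continuous functionals and their restrictions to homogeneous polynomials. -/

namespace HolomorphyType

variable {E : Type*} [NormedAddCommGroup E] [NormedSpace ℂ E] {Θ : HolomorphyType E} {k : ℝ≥0∞}

theorem expNorm_apply (ρ : Set.Ioi (0 : ℝ)) (f : Θ.Exp k) :
    Θ.expNorm k ρ f = ∑' j : ℕ, (ρ : ℝ)⁻¹ ^ j * orderWeight k j * ‖Exp.coeff j f‖ := rfl

theorem expNorm_anti {ρ ρ' : Set.Ioi (0 : ℝ)} (h : ρ ≤ ρ') (f : Θ.Exp k) :
    Θ.expNorm k ρ' f ≤ Θ.expNorm k ρ f := by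
  refine Summable.tsum_le_tsum (fun j => ?_) (f.summable ρ'.2) (f.summable ρ.2)
  have h0 := orderWeight_nonneg k j
  have h1 : (0 : ℝ) < ρ := ρ.2
  have h2 : (0 : ℝ) < ρ' := ρ'.2
  have h3 : (ρ : ℝ) ≤ ρ' := h
  gcongr

theorem exists_norm_le_expNorm (T : Θ.Exp k →L[ℂ] ℂ) :
    ∃ C : ℝ, 0 ≤ C ∧ ∃ ρ : Set.Ioi (0 : ℝ), ∀ f, ‖T f‖ ≤ C * Θ.expNorm k ρ f := by
  obtain ⟨s, C, -, hC⟩ := Seminorm.bound_of_continuous (withSeminorms Θ k)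
    ((normSeminorm ℂ ℂ).comp T.toLinearMap) (continuous_norm.comp T.continuous)
  -- The norms decrease as `ρ` grows, so a lower bound of the finitely many parameters gives a
  -- single dominating norm.
  obtain ⟨ρ, hρ⟩ := s.bddBelow
  refine ⟨C, C.2, ρ, fun f => (hC f).trans ?_⟩
  have : (s.sup (Θ.expNorm k)) f ≤ Θ.expNorm k ρ f :=
    Seminorm.finset_sup_apply_le (apply_nonneg _ _) fun i hi => expNorm_anti (hρ hi) f
  exact mul_le_mul_of_nonneg_left this C.2

variable (k) in
/-- The inclusion of `𝒫_Θ(ⁿE)` into `Exp^k_{Θ,0}(E)`. -/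
def Exp.ofPoly (n : ℕ) : Θ.Poly n →ₗ[ℂ] Θ.Exp k where
  toFun P := Exp.mk P (poly_mem_exp k P.2)
  map_add' _ _ := rfl
  map_smul' _ _ := rfl

theorem Exp.coeff_ofPoly_self (n : ℕ) (P : Θ.Poly n) : Exp.coeff n (Exp.ofPoly k n P) = P := by
  refine Subtype.ext ?_
  have := taylorPoly_homPoly_zero (Θ.le_homPoly n P.2) n
  rwa [if_pos rfl] at this

theorem Exp.coeff_ofPoly_of_ne {n j : ℕ} (h : j ≠ n) (P : Θ.Poly n) :
    Exp.coeff j (Exp.ofPoly k n P) = 0 := by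
  refine Subtype.ext ?_
  have := taylorPoly_homPoly_zero (Θ.le_homPoly n P.2) j
  rwa [if_neg h] at this

theorem expNorm_ofPoly (ρ : Set.Ioi (0 : ℝ)) (n : ℕ) (P : Θ.Poly n) :
    Θ.expNorm k ρ (Exp.ofPoly k n P) = (ρ : ℝ)⁻¹ ^ n * orderWeight k n * ‖P‖ := by
  rw [expNorm_apply, tsum_eq_single n, Exp.coeff_ofPoly_self]
  intro j hj
  rw [Exp.coeff_ofPoly_of_ne hj, norm_zero, mul_zero]

/-- The restriction of a continuous functional on `Exp^k_{Θ,0}(E)` to `𝒫_Θ(ⁿE)`. -/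
noncomputable def restrictPoly (T : Θ.Exp k →L[ℂ] ℂ) (n : ℕ) : Θ.Poly n →L[ℂ] ℂ :=
  LinearMap.mkContinuousOfExistsBound (T.toLinearMap.comp (Exp.ofPoly k n)) (by
    obtain ⟨C, -, ρ, hT⟩ := exists_norm_le_expNorm T
    refine ⟨C * ((ρ : ℝ)⁻¹ ^ n * orderWeight k n), fun P => (hT _).trans (le_of_eq ?_)⟩
    rw [expNorm_ofPoly, mul_assoc C])

theorem restrictPoly_apply (T : Θ.Exp k →L[ℂ] ℂ) (n : ℕ) (P : Θ.Poly n) :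
    restrictPoly T n P = T (Exp.ofPoly k n P) := rfl

theorem exists_norm_restrictPoly_le (T : Θ.Exp k →L[ℂ] ℂ) : ∃ C : ℝ, 0 ≤ C ∧ ∃ B : ℝ, 0 < B ∧
    ∀ n, ‖restrictPoly T n‖ ≤ C * B ^ n * orderWeight k n := by
  obtain ⟨C, hC, ρ, hT⟩ := exists_norm_le_expNorm T
  have hρ : (0 : ℝ) < ρ := ρ.2
  refine ⟨C, hC, (ρ : ℝ)⁻¹, by positivity, fun n => ?_⟩
  have := orderWeight_nonneg k n
  refine ContinuousLinearMap.opNorm_le_bound _ (by positivity) fun P => (hT _).trans (le_of_eq ?_)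
  rw [expNorm_ofPoly]
  ring

/-- Taylor series converge in `Exp^k_{Θ,0}(E)`: the remainder after `N` terms has norm equal to the
tail of the series that defines the norm of `f`. Hence `T` is determined by its restrictions. -/
theorem hasSum_restrictPoly (T : Θ.Exp k →L[ℂ] ℂ) (f : Θ.Exp k) :
    HasSum (fun n => restrictPoly T n (Exp.coeff n f)) (T f) := by
  obtain ⟨C, hC, ρ, hT⟩ := exists_norm_le_expNorm T
  have hρ : (0 : ℝ) < ρ := ρ.2
  set a : ℕ → ℝ := fun j => (ρ : ℝ)⁻¹ ^ j * orderWeight k j * ‖Exp.coeff j f‖ with ha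
  have ha0 : ∀ j, 0 ≤ a j := fun j => by
    have := orderWeight_nonneg k j
    positivity
  have hsum : Summable a := f.summable hρ
  have hbound : ∀ n, ‖restrictPoly T n (Exp.coeff n f)‖ ≤ C * a n := by
    intro n
    rw [restrictPoly_apply]
    refine (hT _).trans (le_of_eq ?_)
    rw [expNorm_ofPoly]
  have hS : Summable fun n => restrictPoly T n (Exp.coeff n f) :=
    Summable.of_norm_bounded (hsum.mul_left C) hbound
  rw [hS.hasSum_iff_tendsto_nat, tendsto_iff_norm_sub_tendsto_zero]
  have hlim : Filter.Tendsto (fun N => C * ∑' j, a (j + N)) Filter.atTop (𝓝 0) := by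
    simpa using (tendsto_sum_nat_add a).const_mul C
  refine squeeze_zero (fun N => norm_nonneg _) (fun N => ?_) hlim
  set r : Θ.Exp k := f - ∑ n ∈ Finset.range N, Exp.ofPoly k n (Exp.coeff n f) with hr
  have hcoeff : ∀ j, Exp.coeff j r = if j < N then 0 else Exp.coeff j f := by
    intro j
    have h0 : ∀ n ≠ j, Exp.coeff j (Exp.ofPoly k n (Exp.coeff n f)) = 0 := fun n hn =>
      Exp.coeff_ofPoly_of_ne (Ne.symm hn) _
    rw [hr, map_sub, map_sum]
    split_ifs with hj
    · rw [Finset.sum_eq_single_of_mem j (Finset.mem_range.2 hj) (fun n _ hn => h0 n hn),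
        Exp.coeff_ofPoly_self, sub_self]
    · rw [Finset.sum_eq_zero, sub_zero]
      intro n hn
      exact h0 n (by rintro rfl; exact hj (Finset.mem_range.1 hn))
  have hnorm : Θ.expNorm k ρ r = ∑' j, a (j + N) := by
    rw [expNorm_apply, ← (r.summable hρ).sum_add_tsum_nat_add N, Finset.sum_eq_zero, zero_add]
    · refine tsum_congr fun j => ?_
      rw [hcoeff, if_neg (by omega)]
    · intro j hj
      rw [hcoeff, if_pos (Finset.mem_range.1 hj), norm_zero, mul_zero]
  have e : ∑ n ∈ Finset.range N, restrictPoly T n (Exp.coeff n f) - T f = -T r := by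
    rw [hr, map_sub, map_sum]
    simp only [restrictPoly_apply]
    ring
  rw [e, norm_neg, ← hnorm]
  exact hT r

/-! ### The Fourier-Borel transform as an entire function of dual type. -/

section FourierBorel

variable (h : Θ.IsPi1) (hk : 1 < k)

theorem coeff_expFun (φ : E →L[ℂ] ℂ) (n : ℕ) : Exp.coeff n (expFun h hk φ) =
    (n.factorial : ℂ)⁻¹ • Θ.elt _ (h.pow_mem n φ) :=
  Subtype.ext (taylorPoly_exp φ n)

theorem hasSum_fourierBorel (T : Θ.Exp k →L[ℂ] ℂ) (φ : E →L[ℂ] ℂ) :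
    HasSum (fun n => borel h n ((n.factorial : ℂ)⁻¹ • restrictPoly T n) φ)
      (fourierBorel h hk T φ) := by
  have := hasSum_restrictPoly T (expFun h hk φ)
  simp only [coeff_expFun, map_smul] at this
  exact this

theorem borel_smul_arg (n : ℕ) (S : Θ.Poly n →L[ℂ] ℂ) (t : ℂ) (φ : E →L[ℂ] ℂ) :
    borel h n S (t • φ) = t ^ n * borel h n S φ := by
  have e : Θ.elt _ (h.pow_mem n (t • φ)) = t ^ n • Θ.elt _ (h.pow_mem n φ) :=
    Subtype.ext (funext fun x => mul_pow t (φ x) n)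
  change S (Θ.elt _ (h.pow_mem n (t • φ))) = _
  rw [e, map_smul]
  rfl

/-- The `n`-th coefficient is the restriction of `T` to degree `n`, divided by `n!` and composed
with the product map. Its norm is at most `C (AB)ⁿ w_k(n) / n!`, summable against every `rⁿ` because
`k > 1`. A single series with infinite radius is needed for `analyticAt_compEntire`, where local
analyticity would not be enough. -/
theorem exists_hasFPowerSeriesOnBall_fourierBorel (T : Θ.Exp k →L[ℂ] ℂ) :
    ∃ p : FormalMultilinearSeries ℂ (E →L[ℂ] ℂ) ℂ,
      HasFPowerSeriesOnBall (fourierBorel h hk T) p 0 ⊤ := by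
  obtain ⟨A, hA, hprod⟩ := h.norm_prodMultilinear_le
  obtain ⟨C, hC, B, hB, hT⟩ := exists_norm_restrictPoly_le T
  let M : ∀ n, ContinuousMultilinearMap ℂ (fun _ : Fin n => E →L[ℂ] ℂ) (Θ.Poly n) := fun n =>
    (h.prodMultilinear n).mkContinuous (A ^ n) (hprod n)
  have hM : ∀ n, ‖M n‖ ≤ A ^ n := fun n =>
    MultilinearMap.mkContinuous_norm_le _ (by positivity) _
  let p : FormalMultilinearSeries ℂ (E →L[ℂ] ℂ) ℂ := fun n =>
    ((n.factorial : ℂ)⁻¹ • restrictPoly T n).compContinuousMultilinearMap (M n)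
  have hp : ∀ n, ‖p n‖ ≤ C * ((A * B) ^ n * orderWeight k n / n.factorial) := by
    intro n
    calc ‖p n‖ ≤ ‖(n.factorial : ℂ)⁻¹ • restrictPoly T n‖ * ‖M n‖ :=
          ContinuousLinearMap.norm_compContinuousMultilinearMap_le _ _
      _ ≤ ((n.factorial : ℝ)⁻¹ * (C * B ^ n * orderWeight k n)) * A ^ n := by
          rw [norm_smul, norm_inv, Complex.norm_natCast]
          have := orderWeight_nonneg k n
          gcongr
          · exact hT n
          · exact hM n
      _ = _ := by rw [mul_pow]; ring
  refine ⟨p, ?_, ENNReal.zero_lt_top, fun {φ} _ => ?_⟩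
  · rw [p.radius_eq_top_of_summable_norm]
    intro r
    refine Summable.of_nonneg_of_le (fun n => by positivity) (fun n => ?_)
      ((summable_orderWeight_exp hk (R := A * B * r) (by positivity)).mul_left C)
    calc ‖p n‖ * (r : ℝ) ^ n
        ≤ C * ((A * B) ^ n * orderWeight k n / n.factorial) * (r : ℝ) ^ n := by
          gcongr; exact hp n
      _ = _ := by rw [mul_pow (A * B)]; ring
  · rw [zero_add]
    have e : ∀ n, p n (fun _ => φ) = borel h n ((n.factorial : ℂ)⁻¹ • restrictPoly T n) φ := by
      intro n
      have : h.prodMultilinear n (fun _ => φ) = Θ.elt _ (h.pow_mem n φ) :=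
        Subtype.ext (funext fun x => by
          change ∏ _ : Fin n, φ x = φ x ^ n
          simp)
      change ((n.factorial : ℂ)⁻¹ • restrictPoly T n) (h.prodMultilinear n fun _ => φ) = _
      rw [this]
      rfl
    simp only [e]
    exact hasSum_fourierBorel h hk T φ

theorem entire_of_hasFPowerSeriesOnBall_top {V : Type*} [NormedAddCommGroup V] [NormedSpace ℂ V]
    {f : V → ℂ} {p : FormalMultilinearSeries ℂ V ℂ} (hf : HasFPowerSeriesOnBall f p 0 ⊤) :
    Entire f := by
  have := hf.analyticOnNhd
  rwa [Metric.eball_top] at this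

theorem entire_fourierBorel (T : Θ.Exp k →L[ℂ] ℂ) : Entire (fourierBorel h hk T) := by
  obtain ⟨p, hp⟩ := exists_hasFPowerSeriesOnBall_fourierBorel h hk T
  exact entire_of_hasFPowerSeriesOnBall_top hp

theorem taylorPoly_fourierBorel (T : Θ.Exp k →L[ℂ] ℂ) (n : ℕ) :
    taylorPoly n (fourierBorel h hk T) 0 =
      borel h n ((n.factorial : ℂ)⁻¹ • restrictPoly T n) := by
  funext φ
  refine dhat_of_hasSum (entire_fourierBorel h hk T)
    (c := fun n => borel h n ((n.factorial : ℂ)⁻¹ • restrictPoly T n) φ) (fun t => ?_) n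
  rw [zero_add]
  simpa only [borel_smul_arg] using hasSum_fourierBorel h hk T (t • φ)

theorem dualNorm_borel (n : ℕ) (S : Θ.Poly n →L[ℂ] ℂ) (hS : borel h n S ∈ dualSpace h n) :
    dualNorm h n ⟨borel h n S, hS⟩ = ‖S‖ := by
  rw [dualNorm]
  congr 1
  exact (LinearEquiv.symm_apply_eq _).2 rfl

theorem fourierBorel_mem_expDual (T : Θ.Exp k →L[ℂ] ℂ) :
    fourierBorel h hk T ∈ ExpDual h (ENNReal.conjExponent k) := by
  obtain ⟨C, hC, B, hB, hT⟩ := exists_norm_restrictPoly_le T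
  have hmem : ∀ j, taylorPoly j (fourierBorel h hk T) 0 ∈ dualSpace h j := fun j => by
    rw [taylorPoly_fourierBorel]
    exact LinearMap.mem_range_self _ _
  -- The product of the weights cancels `1 / j!`, leaving at most `C Bʲ`; with `ρ = 2B` the terms
  -- are dominated by `C (1/2)ʲ`.
  refine ⟨2 * B, by positivity, entire_fourierBorel h hk T, hmem, ?_⟩
  have e : ∀ j, dualNorm h j ⟨_, hmem j⟩ = (j.factorial : ℝ)⁻¹ * ‖restrictPoly T j‖ := by
    intro j
    have := dualNorm_borel h j ((j.factorial : ℂ)⁻¹ • restrictPoly T j)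
      (LinearMap.mem_range_self _ _)
    rw [norm_smul, norm_inv, Complex.norm_natCast] at this
    rw [← this]
    congr 2
    exact taylorPoly_fourierBorel h hk T j
  simp only [e]
  refine Summable.of_nonneg_of_le (fun j => ?_) (fun j => ?_)
    ((summable_geometric_of_lt_one (r := (1 : ℝ) / 2) (by norm_num) (by norm_num)).mul_left C)
  · have := orderWeight_nonneg (ENNReal.conjExponent k) j
    positivity
  · have h1 := orderWeight_nonneg (ENNReal.conjExponent k) j
    have h2 := orderWeight_conjExponent_mul_le hk j
    have h3 : (0 : ℝ) < j.factorial := by positivity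
    calc (2 * B)⁻¹ ^ j * orderWeight (ENNReal.conjExponent k) j *
          ((j.factorial : ℝ)⁻¹ * ‖restrictPoly T j‖)
        ≤ (2 * B)⁻¹ ^ j * orderWeight (ENNReal.conjExponent k) j *
          ((j.factorial : ℝ)⁻¹ * (C * B ^ j * orderWeight k j)) := by
          gcongr; exact hT j
      _ = C * ((2 * B)⁻¹ * B) ^ j * (j.factorial : ℝ)⁻¹ *
          (orderWeight (ENNReal.conjExponent k) j * orderWeight k j) := by
          rw [mul_pow _ B]; ring
      _ ≤ C * ((2 * B)⁻¹ * B) ^ j * (j.factorial : ℝ)⁻¹ * j.factorial := by gcongr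
      _ = C * (1 / 2) ^ j := by
          rw [mul_assoc, inv_mul_cancel₀ h3.ne', mul_one]
          congr 2
          field_simp

/-- The Fourier-Borel transform is injective. -/
theorem exists_fourierBorel_ne_zero {T : Θ.Exp k →L[ℂ] ℂ} (hT : T ≠ 0) :
    ∃ φ, fourierBorel h hk T φ ≠ 0 := by
  by_contra! h0
  have h1 : fourierBorel h hk T = 0 := funext h0
  -- The Taylor polynomials of the transform are Borel transforms of the restrictions of `T`, so
  -- injectivity of each Borel transform makes every restriction vanish.
  have h2 : ∀ n, restrictPoly T n = 0 := by
    intro n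
    have e := taylorPoly_fourierBorel h hk T n
    rw [h1] at e
    have hz : taylorPoly n (0 : (E →L[ℂ] ℂ) → ℂ) 0 = 0 := by
      have := taylorPoly_smul (E := E →L[ℂ] ℂ) (f := 0) (fun _ _ => analyticAt_const) 0 n 0
      simpa using this
    rw [hz, eq_comm] at e
    have e2 := borel_injective h n (e.trans (map_zero (borel h n)).symm)
    have hn : (n.factorial : ℂ)⁻¹ ≠ 0 := inv_ne_zero (by exact_mod_cast n.factorial_ne_zero)
    exact (smul_eq_zero.1 e2).resolve_left hn
  refine hT (ContinuousLinearMap.ext fun f => ?_)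
  have := hasSum_restrictPoly T f
  simp only [h2, zero_apply] at this
  exact this.unique hasSum_zero

end FourierBorel

end HolomorphyType
end HoloType

/-! ### Derivatives of the transform along complex lines. -/

namespace HoloType

/-- The map `g` is arbitrary so that the formula serves both for values at a point and for norms. -/
theorem prod_apply_mixed {V R : Type*} [CommMonoid R] (g : V → R) {n j : ℕ} (hj : j ≤ n)
    (x y : V) [NormedAddCommGroup V] [NormedSpace ℂ V] :
    ∏ i : Fin n, g (mixed j x y i) = g x ^ j * g y ^ (n - j) := by
  have e : ∀ i : Fin n, g (mixed j x y i) = if (i : ℕ) < j then g x else g y := fun i => by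
    rw [mixed, apply_ite g]
  have h1 : (Finset.univ.filter fun i : Fin n => (i : ℕ) < j).card = j := by
    rw [Fin.card_filter_val_lt]; omega
  have h2 : (Finset.univ.filter fun i : Fin n => ¬ (i : ℕ) < j).card = n - j := by
    have := Finset.card_filter_add_card_filter_not (s := (Finset.univ : Finset (Fin n)))
      (fun i : Fin n => (i : ℕ) < j)
    rw [Finset.card_univ, Fintype.card_fin] at this
    omega
  simp only [e]
  rw [Finset.prod_ite, Finset.prod_const, Finset.prod_const, h1, h2]

namespace HolomorphyType

variable {E : Type*} [NormedAddCommGroup E] [NormedSpace ℂ E] {Θ : HolomorphyType E} {k : ℝ≥0∞}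

theorem prodMultilinear_mixed_apply (h : Θ.IsPi1) {n j : ℕ} (hj : j ≤ n) (ψ χ : E →L[ℂ] ℂ)
    (x : E) : h.prodMultilinear n (mixed j ψ χ) x = ψ x ^ j * χ x ^ (n - j) :=
  prod_apply_mixed (fun φ : E →L[ℂ] ℂ => φ x) hj ψ χ

theorem entire_pow_mul_exp (ψ χ : E →L[ℂ] ℂ) (j : ℕ) :
    Entire fun x => ψ x ^ j * Complex.exp (χ x) :=
  fun x _ => ((ψ.analyticAt x).pow j).mul (entire_exp χ x trivial)

theorem taylorPoly_pow_mul_exp (h : Θ.IsPi1) (ψ χ : E →L[ℂ] ℂ) (j n : ℕ) :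
    taylorPoly n (fun x => ψ x ^ j * Complex.exp (χ x)) 0 =
      if j ≤ n then (((n - j).factorial : ℂ)⁻¹ • h.prodMultilinear n (mixed j ψ χ) : Θ.Poly n)
      else (0 : Θ.Poly n) := by
  funext x
  let c : ℕ → ℂ := fun n =>
    if j ≤ n then ((n - j).factorial : ℂ)⁻¹ * (ψ x ^ j * χ x ^ (n - j)) else 0
  have h1 : ∀ t : ℂ, HasSum (fun n => t ^ n * c n)
      (ψ (0 + t • x) ^ j * Complex.exp (χ (0 + t • x))) := by
    intro t
    have h2 := (entire_exp χ).hasSum_line 0 x t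
    simp only [taylorPoly_exp] at h2
    have h3 := h2.mul_left (ψ (0 + t • x) ^ j)
    -- Multiplication by `ψʲ` shifts the exponential series by `j` degrees; the first `j`
    -- coefficients are zero.
    refine (hasSum_nat_add_iff' (f := fun n => t ^ n * c n) j).1 ?_
    rw [Finset.sum_eq_zero, sub_zero]
    · refine h3.congr_fun fun n => ?_
      simp only [c, Nat.le_add_left, if_true, Nat.add_sub_cancel, zero_add, map_smul, smul_eq_mul,
        Pi.smul_apply]
      ring
    · intro n hn
      simp only [c, if_neg (not_le.2 (Finset.mem_range.1 hn)), mul_zero]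
  rw [dhat_of_hasSum (entire_pow_mul_exp ψ χ j) h1 n]
  by_cases hj : j ≤ n
  · simp only [c, if_pos hj, map_smul, Pi.smul_apply, smul_eq_mul,
      prodMultilinear_mixed_apply h hj]
  · simp only [c, if_neg hj, map_zero, Pi.zero_apply]

theorem norm_prodMultilinear_mixed_le (h : Θ.IsPi1) {A : ℝ} (hA : 0 < A)
    (hprod : ∀ (n : ℕ) (φ : Fin n → E →L[ℂ] ℂ), ‖h.prodMultilinear n φ‖ ≤ A ^ n * ∏ i, ‖φ i‖)
    {n j : ℕ} (hj : j ≤ n) (ψ χ : E →L[ℂ] ℂ) :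
    ‖h.prodMultilinear n (mixed j ψ χ)‖ ≤ (A * (‖ψ‖ + ‖χ‖)) ^ n := by
  refine (hprod n _).trans ?_
  rw [prod_apply_mixed (fun φ : E →L[ℂ] ℂ => ‖φ‖) hj, mul_pow]
  gcongr
  calc ‖ψ‖ ^ j * ‖χ‖ ^ (n - j) ≤ (‖ψ‖ + ‖χ‖) ^ j * (‖ψ‖ + ‖χ‖) ^ (n - j) := by
        gcongr
        · linarith [norm_nonneg χ]
        · linarith [norm_nonneg ψ]
    _ = _ := by rw [← pow_add]; congr 1; omega

/-- The left side is `C(n, j) / n!`. The bound recovers the full `1 / n!` needed against `w_k(n)` at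
the cost of a geometric factor. -/
theorem inv_factorial_mul_inv_factorial_le {n j : ℕ} (hj : j ≤ n) :
    (j.factorial : ℝ)⁻¹ * ((n - j).factorial : ℝ)⁻¹ ≤ 2 ^ n / n.factorial := by
  have h1 : ((n.choose j : ℕ) : ℝ) ≤ 2 ^ n := by exact_mod_cast Nat.choose_le_two_pow n j
  rw [Nat.cast_choose ℝ hj] at h1
  have h2 : (0 : ℝ) < n.factorial := by positivity
  rw [le_div_iff₀ h2]
  refine le_trans (le_of_eq ?_) h1
  field_simp

theorem pow_mul_exp_mem (h : Θ.IsPi1) (hk : 1 < k) (ψ χ : E →L[ℂ] ℂ) (j : ℕ) :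
    (fun x => ψ x ^ j * Complex.exp (χ x)) ∈ Θ.expSubmodule k := by
  intro ρ hρ
  obtain ⟨A, hA, hprod⟩ := h.norm_prodMultilinear_le
  have hm : ∀ n, taylorPoly n (fun x => ψ x ^ j * Complex.exp (χ x)) 0 ∈ Θ.space n := fun n => by
    rw [taylorPoly_pow_mul_exp h]
    split_ifs
    · exact ((_ : Θ.Poly n)).2
    · exact (0 : Θ.Poly n).2
  refine ⟨entire_pow_mul_exp ψ χ j, hm, ?_⟩
  set D := A * (‖ψ‖ + ‖χ‖) with hD
  have hD0 : 0 ≤ D := by positivity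
  refine Summable.of_nonneg_of_le (fun n => ?_) (fun n => ?_)
    ((summable_orderWeight_exp hk (R := ρ⁻¹ * (2 * D)) (by positivity)).mul_left
      (j.factorial : ℝ))
  · have := orderWeight_nonneg k n
    positivity
  · have h0 := orderWeight_nonneg k n
    have e : Θ.elt _ (hm n) = if j ≤ n then
        ((n - j).factorial : ℂ)⁻¹ • h.prodMultilinear n (mixed j ψ χ) else 0 :=
      Subtype.ext ((taylorPoly_pow_mul_exp h ψ χ j n).trans (by split_ifs <;> rfl))
    rw [e]
    split_ifs with hj
    · rw [norm_smul, norm_inv, Complex.norm_natCast]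
      have h1 := inv_factorial_mul_inv_factorial_le hj
      have hjf : (0 : ℝ) < j.factorial := by positivity
      rw [inv_mul_le_iff₀ hjf] at h1
      calc ρ⁻¹ ^ n * orderWeight k n *
            (((n - j).factorial : ℝ)⁻¹ * ‖h.prodMultilinear n (mixed j ψ χ)‖)
          ≤ ρ⁻¹ ^ n * orderWeight k n * ((j.factorial * (2 ^ n / n.factorial)) * D ^ n) := by
            gcongr
            exact norm_prodMultilinear_mixed_le h hA hprod hj ψ χ
        _ = _ := by rw [mul_pow ρ⁻¹, mul_pow 2]; ring
    · rw [norm_zero, mul_zero]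
      positivity

/-- The function `ψʲ e^χ` as an element of `Exp^k_{Θ,0}(E)`. -/
noncomputable def powMulExp (h : Θ.IsPi1) (hk : 1 < k) (ψ χ : E →L[ℂ] ℂ) (j : ℕ) : Θ.Exp k :=
  Exp.mk _ (pow_mul_exp_mem h hk ψ χ j)

variable (h : Θ.IsPi1) (hk : 1 < k)

theorem coeff_powMulExp (ψ χ : E →L[ℂ] ℂ) (j n : ℕ) : Exp.coeff n (powMulExp h hk ψ χ j) =
    if j ≤ n then ((n - j).factorial : ℂ)⁻¹ • h.prodMultilinear n (mixed j ψ χ) else 0 :=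
  Subtype.ext ((taylorPoly_pow_mul_exp h ψ χ j n).trans (by split_ifs <;> rfl))

theorem elt_add_smul_pow (χ ψ : E →L[ℂ] ℂ) (t : ℂ) (n : ℕ) :
    Θ.elt _ (h.pow_mem n (χ + t • ψ)) = ∑ j ∈ Finset.range (n + 1),
      (t ^ j * n.choose j) • h.prodMultilinear n (mixed j ψ χ) := by
  have hinj : Function.Injective (Θ.toFun n) := Subtype.val_injective
  apply hinj
  rw [map_sum]
  funext x
  rw [Finset.sum_apply]
  change (χ x + t * ψ x) ^ n = _
  rw [add_comm, add_pow]
  refine Finset.sum_congr rfl fun j hj => ?_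
  rw [map_smul, Pi.smul_apply,
    prodMultilinear_mixed_apply h (Nat.lt_succ_iff.1 (Finset.mem_range.1 hj)), smul_eq_mul]
  ring

/-- This is `T` applied termwise to `e^(χ + tψ) = ∑ tʲ ψʲ e^χ / j!`. The justification is an
absolutely summable double series indexed by the degree `n` and the power `j`. Summing over `j`
gives the degree-`n` term of the transform by the binomial formula; summing over `n` gives the
coefficient of `tʲ`. -/
theorem hasSum_fourierBorel_line (T : Θ.Exp k →L[ℂ] ℂ) (χ ψ : E →L[ℂ] ℂ) (t : ℂ) :
    HasSum (fun j : ℕ => t ^ j * ((j.factorial : ℂ)⁻¹ * T (powMulExp h hk ψ χ j)))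
      (fourierBorel h hk T (χ + t • ψ)) := by
  obtain ⟨A, hA, hprod⟩ := h.norm_prodMultilinear_le
  obtain ⟨C, hC, B, hB, hT⟩ := exists_norm_restrictPoly_le T
  let a : ℕ × ℕ → ℂ := fun q => if q.2 ≤ q.1 then t ^ q.2 * ((q.2.factorial : ℂ)⁻¹ *
    (((q.1 - q.2).factorial : ℂ)⁻¹ * restrictPoly T q.1 (h.prodMultilinear q.1 (mixed q.2 ψ χ))))
    else 0
  have hrow : ∀ n, HasSum (fun j => a (n, j))
      (borel h n ((n.factorial : ℂ)⁻¹ • restrictPoly T n) (χ + t • ψ)) := by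
    intro n
    have e : borel h n ((n.factorial : ℂ)⁻¹ • restrictPoly T n) (χ + t • ψ) =
        ∑ j ∈ Finset.range (n + 1), a (n, j) := by
      change (n.factorial : ℂ)⁻¹ * restrictPoly T n (Θ.elt _ (h.pow_mem n (χ + t • ψ))) = _
      rw [elt_add_smul_pow h, map_sum, Finset.mul_sum]
      refine Finset.sum_congr rfl fun j hj => ?_
      have hj' := Nat.lt_succ_iff.1 (Finset.mem_range.1 hj)
      have h1 : (n.factorial : ℂ) ≠ 0 := by exact_mod_cast n.factorial_ne_zero
      have h2 : (j.factorial : ℂ) ≠ 0 := by exact_mod_cast j.factorial_ne_zero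
      have h3 : ((n - j).factorial : ℂ) ≠ 0 := by exact_mod_cast (n - j).factorial_ne_zero
      simp only [a, if_pos hj', map_smul, smul_eq_mul, Nat.cast_choose ℂ hj']
      field_simp
    rw [e]
    refine hasSum_sum_of_ne_finset_zero fun j hj => ?_
    simp only [a, if_neg (show ¬ j ≤ n by simpa [Nat.lt_succ_iff] using hj)]
  have hcol : ∀ j, HasSum (fun n => a (n, j))
      (t ^ j * ((j.factorial : ℂ)⁻¹ * T (powMulExp h hk ψ χ j))) := by
    intro j
    refine (((hasSum_restrictPoly T (powMulExp h hk ψ χ j)).mul_left _).mul_left _).congr_fun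
      fun n => ?_
    simp only [coeff_powMulExp, a]
    split_ifs
    · rw [map_smul, smul_eq_mul]
    · simp
  set D := A * (‖ψ‖ + ‖χ‖) with hD
  have hD0 : 0 ≤ D := by positivity
  set τ := ‖t‖ with hτ
  have hτ0 : 0 ≤ τ := norm_nonneg t
  have ha : Summable a := by
    have hgeo : Summable fun n : ℕ => ((1 : ℝ) / 2) ^ n :=
      summable_geometric_of_lt_one (by norm_num) (by norm_num)
    -- In `R`, the factor `2 (τ + 1)` absorbs `τʲ` and leaves `(1/2)ʲ` for summation over `j`; the
    -- next `2` comes from the binomial coefficient, `B` from the restriction of `T`, and `D` from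
    -- the product of functionals.
    have hw := (summable_orderWeight_exp hk (R := (2 * (τ + 1)) * 2 * B * D)
      (by positivity)).mul_left C
    have hw0 : ∀ n, 0 ≤ C * (((2 * (τ + 1)) * 2 * B * D) ^ n * orderWeight k n / n.factorial) :=
      fun n => by
        have := orderWeight_nonneg k n
        positivity
    refine Summable.of_norm_bounded
      (hw.mul_of_nonneg hgeo hw0 (fun n => by positivity)) ?_
    rintro ⟨n, j⟩
    by_cases hj : j ≤ n
    · have h0 := orderWeight_nonneg k n
      have h1 : τ ^ j ≤ (2 * (τ + 1)) ^ n * (1 / 2) ^ j := by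
        calc τ ^ j ≤ (τ + 1) ^ j := by gcongr; linarith
          _ = (2 * (τ + 1)) ^ j * (1 / 2) ^ j := by rw [← mul_pow]; congr 1; ring
          _ ≤ _ := by gcongr; · linarith
      have h2 : ‖restrictPoly T n (h.prodMultilinear n (mixed j ψ χ))‖ ≤
          C * B ^ n * orderWeight k n * D ^ n :=
        (ContinuousLinearMap.le_opNorm _ _).trans (mul_le_mul (hT n)
          (norm_prodMultilinear_mixed_le h hA hprod hj ψ χ) (norm_nonneg _) (by positivity))
      simp only [a, if_pos hj, norm_mul, norm_pow, norm_inv, Complex.norm_natCast]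
      calc τ ^ j * ((j.factorial : ℝ)⁻¹ * (((n - j).factorial : ℝ)⁻¹ *
            ‖restrictPoly T n (h.prodMultilinear n (mixed j ψ χ))‖))
          = τ ^ j * (((j.factorial : ℝ)⁻¹ * ((n - j).factorial : ℝ)⁻¹) *
            ‖restrictPoly T n (h.prodMultilinear n (mixed j ψ χ))‖) := by ring
        _ ≤ ((2 * (τ + 1)) ^ n * (1 / 2) ^ j) * ((2 ^ n / n.factorial) *
            (C * B ^ n * orderWeight k n * D ^ n)) := by
            gcongr
            exact inv_factorial_mul_inv_factorial_le hj
        _ = _ := by rw [mul_pow _ D, mul_pow _ B, mul_pow _ 2]; ring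
    · simp only [a, if_neg hj, norm_zero]
      have := hw0 n
      positivity
  have h1 := ha.hasSum.prod_fiberwise hrow
  have h2 := ((Equiv.prodComm ℕ ℕ).hasSum_iff.2 ha.hasSum).prod_fiberwise hcol
  rw [(hasSum_fourierBorel h hk T (χ + t • ψ)).unique h1]
  exact h2

theorem iteratedDeriv_fourierBorel_line (T : Θ.Exp k →L[ℂ] ℂ) (χ ψ : E →L[ℂ] ℂ) (j : ℕ) (t : ℂ) :
    iteratedDeriv j (fun s : ℂ => fourierBorel h hk T (χ + s • ψ)) t =
      T (powMulExp h hk ψ (χ + t • ψ) j) := by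
  have h1 := iteratedDeriv_of_hasSum (hasSum_fourierBorel_line h hk T (χ + t • ψ) ψ) j
  have h2 := congrFun (iteratedDeriv_comp_add_const j
    (fun s : ℂ => fourierBorel h hk T (χ + s • ψ)) t) 0
  have e : (fun s : ℂ => fourierBorel h hk T (χ + (s + t) • ψ)) =
      fun s : ℂ => fourierBorel h hk T (χ + t • ψ + s • ψ) := by
    funext s
    congr 1
    ext x
    simp
    ring
  have hj : (j.factorial : ℂ) ≠ 0 := by exact_mod_cast j.factorial_ne_zero
  rw [zero_add, e, h1] at h2
  rw [← h2, mul_inv_cancel_left₀ hj]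

/-- The span of the `ψⁱ e^χ` with `i ≤ j` is translation invariant, by the binomial formula and the
addition law of the exponential. -/
theorem conv_powMulExp_eq_zero (T : Θ.Exp k →L[ℂ] ℂ) (ψ χ : E →L[ℂ] ℂ) (j : ℕ)
    (hT : ∀ i ≤ j, T (powMulExp h hk ψ χ i) = 0) : conv hk.le T (powMulExp h hk ψ χ j) = 0 := by
  funext x
  have e : translate hk.le x (powMulExp h hk ψ χ j) = ∑ i ∈ Finset.range (j + 1),
      (ψ x ^ (j - i) * j.choose i * Complex.exp (χ x)) • powMulExp h hk ψ χ i := by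
    have hinj : Function.Injective (Exp.toFun Θ k) := Subtype.val_injective
    apply hinj
    rw [map_sum]
    funext y
    rw [Finset.sum_apply]
    change ψ (y + x) ^ j * Complex.exp (χ (y + x)) = _
    rw [map_add, map_add, Complex.exp_add, add_pow, Finset.sum_mul]
    refine Finset.sum_congr rfl fun i _ => ?_
    rw [map_smul, Pi.smul_apply]
    change _ = _ * (ψ y ^ i * Complex.exp (χ y))
    ring
  change T (translate hk.le x (powMulExp h hk ψ χ j)) = 0
  rw [e, map_sum]
  refine Finset.sum_eq_zero fun i hi => ?_
  rw [map_smul, hT i (Nat.lt_succ_iff.1 (Finset.mem_range.1 hi)), smul_zero]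

/-- The kernel condition becomes an inequality of multiplicities. Only the exponential polynomials
`ψʲ e^φ` are tested. -/
theorem analyticOrderAt_fourierBorel_line_le (T₁ T₂ : Θ.Exp k →L[ℂ] ℂ)
    (hker : ∀ (m : ℕ) (P : Θ.Poly m) (φ : E →L[ℂ] ℂ)
      (hP : (fun x => P x * Complex.exp (φ x)) ∈ Θ.expSubmodule k),
      conv hk.le T₂ (Exp.mk _ hP) = 0 → T₁ (Exp.mk _ hP) = 0) (χ ψ : E →L[ℂ] ℂ) (t : ℂ) :
    analyticOrderAt (fun s : ℂ => fourierBorel h hk T₂ (χ + s • ψ)) t ≤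
      analyticOrderAt (fun s : ℂ => fourierBorel h hk T₁ (χ + s • ψ)) t := by
  have han : ∀ T : Θ.Exp k →L[ℂ] ℂ,
      AnalyticAt ℂ (fun s : ℂ => fourierBorel h hk T (χ + s • ψ)) t := fun T =>
    ((entire_fourierBorel h hk T).differentiable_line χ ψ).analyticAt t
  -- Comparing through natural numbers also covers infinite order, when `𝓕T₂` vanishes identically
  -- on the line.
  refine ENat.forall_natCast_le_iff_le.1 fun n hn => ?_
  rw [natCast_le_analyticOrderAt_iff_iteratedDeriv_eq_zero (han T₂)] at hn
  rw [natCast_le_analyticOrderAt_iff_iteratedDeriv_eq_zero (han T₁)]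
  simp only [iteratedDeriv_fourierBorel_line] at hn ⊢
  intro j hj
  exact hker j (Θ.elt _ (h.pow_mem j ψ)) (χ + t • ψ) (pow_mul_exp_mem h hk ψ _ j)
    (conv_powMulExp_eq_zero h hk T₂ ψ _ j fun i hi => hn i (by omega))

end HolomorphyType
end HoloType

/-! ### Gluing of local quotients and division in one variable. -/

namespace HoloType

section Gluing

variable {V : Type*} [NormedAddCommGroup V] [NormedSpace ℂ V]

/-- Local analytic quotients of `f` by `g` are the restrictions of one entire quotient. -/
theorem exists_entire_quotient_of_local {f g : V → ℂ} (hg : ∀ x, ∃ᶠ y in 𝓝 x, g y ≠ 0)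
    (hloc : ∀ x, ∃ u : V → ℂ, AnalyticAt ℂ u x ∧ ∀ᶠ y in 𝓝 x, f y = u y * g y) :
    ∃ h : V → ℂ, Entire h ∧ ∀ x, f x = h x * g x := by
  choose u hu huq using hloc
  -- The global quotient takes at `x` the value of the local quotient chosen at `x`. Two local
  -- quotients that differed at `y` would differ near `y` by continuity, hence also at a nearby
  -- point where `g ≠ 0`, which is impossible.
  refine ⟨fun x => u x x, fun x _ => (hu x).congr ?_, fun x => (huq x).self_of_nhds⟩
  filter_upwards [(hu x).eventually_analyticAt, (huq x).eventually_nhds] with y hy hyq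
  by_contra hne
  have hc : ContinuousAt (fun z => u x z - u y z) y := hy.continuousAt.sub (hu y).continuousAt
  obtain ⟨z, hgz, hz, h1, h2⟩ :=
    ((hg y).and_eventually ((hc.eventually_ne (sub_ne_zero.2 hne)).and (hyq.and (huq y)))).exists
  exact hz (sub_eq_zero.2 (mul_right_cancel₀ hgz (h1.symm.trans h2)))

theorem Entire.frequently_ne_zero {g : V → ℂ} (hg : Entire g) (hne : ∃ x, g x ≠ 0) (x : V) :
    ∃ᶠ y in 𝓝 x, g y ≠ 0 := by
  obtain ⟨x₁, hx₁⟩ := hne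
  intro h0
  have h1 : g =ᶠ[𝓝 x] 0 := h0.mono fun y hy => not_not.1 hy
  exact hx₁ (AnalyticOnNhd.eqOn_zero_of_preconnected_of_eventuallyEq_zero hg isPreconnected_univ
    (Set.mem_univ x) h1 (Set.mem_univ x₁))

end Gluing

/-- An entire function whose zeros have at least the multiplicity that they have for `g` is
divisible by `g`. -/
theorem exists_differentiable_quotient {f g : ℂ → ℂ} (hf : Differentiable ℂ f)
    (hg : Differentiable ℂ g) (hne : ∃ t, g t ≠ 0)
    (hord : ∀ t, analyticOrderAt g t ≤ analyticOrderAt f t) :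
    ∃ q : ℂ → ℂ, Differentiable ℂ q ∧ ∀ t, f t = q t * g t := by
  have hgE : Entire g := fun t _ => hg.analyticAt t
  have hfreq := hgE.frequently_ne_zero hne
  obtain ⟨q, hq, hfq⟩ := exists_entire_quotient_of_local (f := f) hfreq fun t => by
    have htop : analyticOrderAt g t ≠ ⊤ := fun h => by
      rw [analyticOrderAt_eq_top] at h
      obtain ⟨y, hy, hy'⟩ := ((hfreq t).and_eventually h).exists
      exact hy hy'
    obtain ⟨n, hn⟩ := ENat.ne_top_iff_exists.1 htop
    obtain ⟨g₁, hg₁, hg₁t, hgg₁⟩ := (hg.analyticAt t).analyticOrderAt_eq_natCast.1 hn.symm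
    obtain ⟨f₁, hf₁, hff₁⟩ := (natCast_le_analyticOrderAt (hf.analyticAt t)).1
      (hn.trans_le (hord t))
    -- Here `n` is the finite order of `g` at `t`. The factor `(z - t)ⁿ` is cancelled from both
    -- functions and `g₁` does not vanish at `t`.
    refine ⟨fun z => f₁ z / g₁ z, hf₁.div hg₁ hg₁t, ?_⟩
    filter_upwards [hgg₁, hff₁, hg₁.continuousAt.eventually_ne hg₁t] with z h1 h2 h3
    rw [h1, h2, smul_eq_mul, smul_eq_mul]
    field_simp
  exact ⟨q, fun t => (hq t trivial).differentiableAt, hfq⟩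

/-- Zeros are isolated, so small circles around `0` avoid them even if `g 0 = 0`. Such a circle is
the contour for the averaging argument. -/
theorem exists_sphere_ne_zero {g : ℂ → ℂ} (hg : Differentiable ℂ g) (hne : ∃ t, g t ≠ 0) :
    ∃ r : ℝ, 0 < r ∧ ∀ t ∈ Metric.sphere (0 : ℂ) r, g t ≠ 0 := by
  have hgE : Entire g := fun t _ => hg.analyticAt t
  rcases (hg.analyticAt 0).eventually_eq_zero_or_eventually_ne_zero with h0 | h0
  · exact absurd (h0.mono fun y hy => not_not.2 hy) (hgE.frequently_ne_zero hne 0)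
  · rw [eventually_nhdsWithin_iff, Metric.eventually_nhds_iff] at h0
    obtain ⟨ε, hε, h1⟩ := h0
    refine ⟨ε / 2, by positivity, fun t ht => h1 ?_ ?_⟩
    · rw [Metric.mem_sphere.1 ht]; linarith
    · rintro rfl
      have := Metric.mem_sphere.1 ht
      rw [dist_self] at this
      linarith

/-! ### From divisibility on lines to an entire quotient. -/

section ContinuousMaps

variable {V : Type*} [NormedAddCommGroup V] [NormedSpace ℂ V]
variable (S : Type*) [TopologicalSpace S] [CompactSpace S]

/-- The pointwise action of a continuous multilinear form on continuous functions. -/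
noncomputable def pointwiseMultilinear {n : ℕ}
    (B : ContinuousMultilinearMap ℂ (fun _ : Fin n => V) ℂ) :
    ContinuousMultilinearMap ℂ (fun _ : Fin n => C(S, V)) C(S, ℂ) :=
  MultilinearMap.mkContinuous
    { toFun := fun w => ⟨fun s => B fun i => w i s, by fun_prop⟩
      map_update_add' := fun w i a b => by
        ext s
        have e : ∀ c : C(S, V), (fun j => Function.update w i c j s) =
            Function.update (fun j => w j s) i (c s) := fun c => by
          funext j
          by_cases hj : j = i
          · subst hj; simp
          · simp [hj]
        simp [e]
      map_update_smul' := fun w i c a => by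
        ext s
        have e : ∀ c : C(S, V), (fun j => Function.update w i c j s) =
            Function.update (fun j => w j s) i (c s) := fun c => by
          funext j
          by_cases hj : j = i
          · subst hj; simp
          · simp [hj]
        simp [e] } ‖B‖ fun w => by
      refine (ContinuousMap.norm_le _ (by positivity)).2 fun s => (B.le_opNorm _).trans ?_
      gcongr with i
      exact (w i).norm_coe_le_norm s

theorem norm_pointwiseMultilinear_le {n : ℕ}
    (B : ContinuousMultilinearMap ℂ (fun _ : Fin n => V) ℂ) : ‖pointwiseMultilinear S B‖ ≤ ‖B‖ :=
  MultilinearMap.mkContinuous_norm_le _ (norm_nonneg _) _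

/-- Composition with an entire function, as a map between spaces of continuous functions. -/
def compEntire {f : V → ℂ} (hf : Entire f) (w : C(S, V)) : C(S, ℂ) :=
  ⟨fun s => f (w s), hf.contDiff.continuous.comp w.continuous⟩

/-- The power series of `f` acts pointwise on continuous functions without increasing the norms of
its coefficients, so its radius stays infinite. This gives analytic dependence of `f` on a whole
circle of points at once, in place of differentiation under the integral. -/
theorem analyticAt_compEntire {f : V → ℂ} (hf : Entire f) {p : FormalMultilinearSeries ℂ V ℂ}
    (hp : HasFPowerSeriesOnBall f p 0 ⊤) (w : C(S, V)) : AnalyticAt ℂ (compEntire S hf) w := by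
  let P : FormalMultilinearSeries ℂ C(S, V) C(S, ℂ) := fun n => pointwiseMultilinear S (p n)
  have hrad : P.radius = ⊤ := by
    refine P.radius_eq_top_of_summable_norm fun r => ?_
    refine Summable.of_nonneg_of_le (fun n => by positivity) (fun n => ?_)
      (p.radius_eq_top_iff_summable_norm.1 (top_le_iff.1 hp.r_le) r)
    gcongr
    exact norm_pointwiseMultilinear_le S (p n)
  have hP : HasFPowerSeriesOnBall (compEntire S hf) P 0 ⊤ := by
    refine ⟨hrad.ge, ENNReal.zero_lt_top, fun {w} hw => ?_⟩
    have hsum : Summable fun n => P n fun _ => w := P.summable (by rw [hrad]; exact hw)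
    have e : ∑' n, P n (fun _ => w) = compEntire S hf (0 + w) := by
      ext s
      have h1 := hsum.hasSum.mapL (ContinuousMap.evalCLM ℂ s)
      have h2 := hp.hasSum (y := w s) (by simp)
      rw [zero_add] at h2 ⊢
      exact h1.unique h2
    exact e ▸ hsum.hasSum
  exact hP.analyticOnNhd w (by simp)

variable (V) in
/-- The constant functions, as a continuous linear map. -/
noncomputable def constMap : V →L[ℂ] C(S, V) :=
  LinearMap.mkContinuous
    { toFun := ContinuousMap.const S
      map_add' := fun _ _ => rfl
      map_smul' := fun _ _ => rfl } 1 fun x => by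
      rw [one_mul]
      exact (ContinuousMap.norm_le _ (norm_nonneg _)).2 fun _ => le_rfl

/-- The average over a circle, as a continuous linear functional. -/
noncomputable def sphereAverage {r : ℝ} (hr : 0 ≤ r) :
    C(Metric.sphere (0 : ℂ) r, ℂ) →L[ℂ] ℂ :=
  have hcont : ∀ w : C(Metric.sphere (0 : ℂ) r, ℂ), Continuous fun θ : ℝ =>
      w ⟨circleMap 0 r θ, circleMap_mem_sphere 0 hr θ⟩ := fun w =>
    w.continuous.comp ((continuous_circleMap 0 r).subtype_mk _)
  LinearMap.mkContinuous
    { toFun := fun w => (2 * Real.pi)⁻¹ •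
        ∫ θ in (0 : ℝ)..2 * Real.pi, w ⟨circleMap 0 r θ, circleMap_mem_sphere 0 hr θ⟩
      map_add' := fun v w => by
        rw [← smul_add, ← intervalIntegral.integral_add ((hcont v).intervalIntegrable _ _)
          ((hcont w).intervalIntegrable _ _)]
        rfl
      map_smul' := fun c w => by
        rw [RingHom.id_apply, smul_comm c]
        congr 1
        exact intervalIntegral.integral_smul c _ } 1 fun w => by
      have h1 := intervalIntegral.norm_integral_le_of_norm_le_const (a := 0) (b := 2 * Real.pi)
        (f := fun θ => w ⟨circleMap 0 r θ, circleMap_mem_sphere 0 hr θ⟩) (C := ‖w‖)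
        fun θ _ => w.norm_coe_le_norm _
      have hpi := Real.pi_pos
      rw [sub_zero, abs_of_pos (by positivity)] at h1
      change ‖(2 * Real.pi)⁻¹ • (_ : ℂ)‖ ≤ _
      rw [norm_smul, norm_inv, Real.norm_of_nonneg (by positivity), one_mul,
        inv_mul_le_iff₀ (by positivity)]
      linarith

/-- This is the mean value property. It recovers the quotient at the centre, where `g` may vanish,
from the circle, where it does not. -/
theorem sphereAverage_eq_center {r : ℝ} (hr : 0 ≤ r) {q : ℂ → ℂ} (hq : Differentiable ℂ q)
    (w : C(Metric.sphere (0 : ℂ) r, ℂ)) (hw : ∀ s, w s = q s) : sphereAverage hr w = q 0 := by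
  rw [← (hq.diffContOnCl (s := Metric.ball 0 |r|)).circleAverage, Real.circleAverage]
  change (2 * Real.pi)⁻¹ • (∫ θ in (0 : ℝ)..2 * Real.pi,
    w ⟨circleMap 0 r θ, circleMap_mem_sphere 0 hr θ⟩) = _
  simp only [hw]

/-- If `f` is divisible by `g` on every complex line on which `g` does not vanish identically, then
it is divisible by `g`. -/
theorem exists_entire_quotient_of_lines {f g : V → ℂ} {p p' : FormalMultilinearSeries ℂ V ℂ}
    (hf : HasFPowerSeriesOnBall f p 0 ⊤) (hg : HasFPowerSeriesOnBall g p' 0 ⊤)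
    (hne : ∃ x, g x ≠ 0)
    (hline : ∀ x v : V, (∃ t : ℂ, g (x + t • v) ≠ 0) →
      ∃ q : ℂ → ℂ, Differentiable ℂ q ∧ ∀ t : ℂ, f (x + t • v) = q t * g (x + t • v)) :
    ∃ h : V → ℂ, Entire h ∧ ∀ x, f x = h x * g x := by
  have hfE : Entire f := HolomorphyType.entire_of_hasFPowerSeriesOnBall_top hf
  have hgE : Entire g := HolomorphyType.entire_of_hasFPowerSeriesOnBall_top hg
  refine exists_entire_quotient_of_local (hgE.frequently_ne_zero hne) fun x₀ => ?_
  obtain ⟨x₁, hx₁⟩ := hne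
  -- This direction joins `x₀` to a point where `g` is nonzero, reached at `t = 1`, so `g` is not
  -- identically zero on the line.
  set v := x₁ - x₀ with hv
  obtain ⟨r, hr, hrg⟩ := exists_sphere_ne_zero (hgE.differentiable_line x₀ v)
    ⟨1, by simpa [hv] using hx₁⟩
  let K := Metric.sphere (0 : ℂ) r
  let c : C(K, V) := ⟨fun s => (s : ℂ) • v, by fun_prop⟩
  -- The circle `s ↦ x + s v` is a point of `C(K, V)` that depends affinely on `x`.
  let w : V → C(K, V) := fun x => constMap V K x + c
  have hwa : AnalyticAt ℂ w x₀ := ((constMap V K).analyticAt x₀).add analyticAt_const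
  have hGa : AnalyticAt ℂ (fun x => compEntire K hgE (w x)) x₀ :=
    (analyticAt_compEntire K hgE hg (w x₀)).comp hwa
  have hFa : AnalyticAt ℂ (fun x => compEntire K hfE (w x)) x₀ :=
    (analyticAt_compEntire K hfE hf (w x₀)).comp hwa
  have hunit : IsUnit (compEntire K hgE (w x₀)) :=
    (ContinuousMap.isUnit_iff_forall_ne_zero _).2 fun s => hrg s s.2
  have hIa : AnalyticAt ℂ (fun x => Ring.inverse (compEntire K hgE (w x))) x₀ :=
    AnalyticAt.comp (g := Ring.inverse) (f := fun x => compEntire K hgE (w x))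
      (analyticAt_inverse (𝕜 := ℂ) hunit.unit) hGa
  -- The local quotient is the average of `f / g` over this circle. It is analytic because inversion
  -- is analytic at units of the Banach algebra `C(K, ℂ)`; openness of the units keeps `g` free of
  -- zeros on the circles around nearby `x`.
  refine ⟨fun x => sphereAverage hr.le (compEntire K hfE (w x) *
    Ring.inverse (compEntire K hgE (w x))),
    ((sphereAverage hr.le).analyticAt _).comp (hFa.mul hIa), ?_⟩
  filter_upwards [hGa.continuousAt.eventually (Units.isOpen.mem_nhds hunit)] with x hx
  have hx : IsUnit (compEntire K hgE (w x)) := hx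
  have hgx : ∀ s : K, g (x + (s : ℂ) • v) ≠ 0 := (ContinuousMap.isUnit_iff_forall_ne_zero _).1 hx
  -- The point `t = r` of the circle witnesses that `g` is not identically zero on the line through
  -- `x`.
  obtain ⟨q, hq, hfq⟩ := hline x v ⟨r, hgx ⟨r, by simp [K, hr.le]⟩⟩
  have h0 := hfq 0
  rw [zero_smul, add_zero] at h0
  rw [h0, sphereAverage_eq_center hr.le hq]
  intro s
  have h1 := DFunLike.congr_fun (Ring.mul_inverse_cancel _ hx) s
  change f (x + (s : ℂ) • v) * Ring.inverse (compEntire K hgE (w x)) s = q s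
  change g (x + (s : ℂ) • v) * Ring.inverse (compEntire K hgE (w x)) s = 1 at h1
  rw [hfq, mul_assoc, h1, mul_one]

end ContinuousMaps

end HoloType

/-! ### The division theorem. -/

open HoloType HolomorphyType in
theorem theorem5p3 {E : Type*} [NormedAddCommGroup E] [NormedSpace ℂ E] [CompleteSpace E]
    (k : ℝ≥0∞) (hk : 1 < k) (Θ : HolomorphyType E) (h₁ : Θ.IsPi1) (_h₂ : Θ.IsPi2 k)
    (hdiv : ClosedUnderDivision (ExpDual h₁ (ENNReal.conjExponent k)))
    (T₁ T₂ : Θ.Exp k →L[ℂ] ℂ) (hT₂ : T₂ ≠ 0)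
    (hker : ∀ (m : ℕ) (P : Θ.Poly m) (φ : E →L[ℂ] ℂ)
      (hP : (fun x => P x * Complex.exp (φ x)) ∈ Θ.expSubmodule k),
      conv hk.le T₂ (Exp.mk _ hP) = 0 → T₁ (Exp.mk _ hP) = 0) :
    ∃ h ∈ ExpDual h₁ (ENNReal.conjExponent k),
      ∀ φ : E →L[ℂ] ℂ, fourierBorel h₁ hk T₁ φ = h φ * fourierBorel h₁ hk T₂ φ := by
  obtain ⟨p₁, hp₁⟩ := exists_hasFPowerSeriesOnBall_fourierBorel h₁ hk T₁
  obtain ⟨p₂, hp₂⟩ := exists_hasFPowerSeriesOnBall_fourierBorel h₁ hk T₂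
  obtain ⟨φ₀, hφ₀⟩ := exists_fourierBorel_ne_zero h₁ hk hT₂
  obtain ⟨h, hh, hq⟩ := exists_entire_quotient_of_lines hp₁ hp₂ ⟨φ₀, hφ₀⟩ fun χ ψ hne =>
    exists_differentiable_quotient ((entire_fourierBorel h₁ hk T₁).differentiable_line χ ψ)
      ((entire_fourierBorel h₁ hk T₂).differentiable_line χ ψ) hne
      (analyticOrderAt_fourierBorel_line_le h₁ hk T₁ T₂ hker χ ψ)
  exact ⟨h, hdiv _ (fourierBorel_mem_expDual h₁ hk T₁) _ (fourierBorel_mem_expDual h₁ hk T₂)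
    (fun h0 => hφ₀ (congrFun h0 φ₀)) h hh hq, hq⟩
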